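/- **Theorem 1.** A finite arithmetic progression (AP) is a set $\{a, a+d, a+2d, \dots, a+md\}$ with $a,d\in\mathbb{Z}$ and $m\in\mathbb{Z}_{\ge 0}$. In Cover by Arithmetic Progressions (CAP) the input is an integer $k\ge 0$ and a set $X$ of $n$ integers (given as a list of distinct integers in arbitrary order), and the question is whether $X$ is the union of at most $k$ APs, each contained in $X$ (they may overlap; for $X\neq\emptyset$ this is the same as being the union of exactly $k$ such APs, repetitions allowed). CAP can be solved in time $2^{O(k^2)}\cdot\mathrm{poly}(n)$. That is, there are a single program for a deterministic random access machine and a constant $C$ such that, on every input $(k,X)$ with $|X|=n$, the program halts after at most $C\cdot 2^{Ck^2}\cdot(n+1)^C$ steps with the correct answer. Here the machine has finitely many integer variables and integer arrays, control by sequencing, if and while, and as elementary operations, each costing one step, loading a constant, addition, subtraction, reading and writing an array cell, and comparing two integers. The bound does not depend on the size of the integers in $X$. -/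

import Mathlib

/-- The set of elements of the arithmetic progression
`a, a + d, a + 2 d, …, a + m d` (`m + 1 ≥ 1` terms, any integer difference `d`). -/
def apSet (a d : ℤ) (m : ℕ) : Set ℤ := {x | ∃ i : ℕ, i ≤ m ∧ x = a + (i : ℤ) * d}

/-- `A` is (the set of elements of) a finite arithmetic progression of integers. -/
def IsAP (A : Set ℤ) : Prop := ∃ (a d : ℤ) (m : ℕ), A = apSet a d m

/-- `(X, k)` is a yes-instance of Cover by Arithmetic Progressions: `X` is the union of at most
`k` arithmetic progressions, each of which is contained in `X`. The progressions may overlap. -/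
def CAP (X : Set ℤ) (k : ℕ) : Prop :=
  ∃ j : ℕ, j ≤ k ∧ ∃ s : Fin j → Set ℤ, (∀ i, IsAP (s i) ∧ s i ⊆ X) ∧ (⋃ i, s i) = X

/-- The store of a random access machine: integer variables (registers) `vars 0, vars 1, …` and
integer arrays `arr 0, arr 1, …`, whose cells are indexed by the integers. A given program
mentions only finitely many variables and arrays. -/
structure RamState where
  vars : ℕ → ℤ
  arr : ℕ → ℤ → ℤ

namespace RamState

/-- Assign the value `v` to variable `x`. -/
def setVar (σ : RamState) (x : ℕ) (v : ℤ) : RamState :=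
  { σ with vars := Function.update σ.vars x v }

/-- Write the value `v` into cell `i` of array `A`. -/
def setCell (σ : RamState) (A : ℕ) (i v : ℤ) : RamState :=
  { σ with arr := Function.update σ.arr A (Function.update (σ.arr A) i v) }

end RamState

/-- Programs of the machine. The only arithmetic is addition and subtraction (no multiplication,
division or bit operations), so charging one step per instruction is polynomially equivalent to
charging for the bit lengths of the numbers involved. -/
inductive RamProg where
  /-- do nothing -/
  | skip : RamProg
  /-- `x := c` for a constant `c` written in the program -/
  | const (x : ℕ) (c : ℤ) : RamProg
  /-- `x := y + z` -/
  | add (x y z : ℕ) : RamProg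
  /-- `x := y - z` -/
  | sub (x y z : ℕ) : RamProg
  /-- `x := A[y]` -/
  | load (x A y : ℕ) : RamProg
  /-- `A[x] := y` -/
  | store (A x y : ℕ) : RamProg
  /-- `p ; q` -/
  | seq (p q : RamProg) : RamProg
  /-- `if x < y then p else q` -/
  | cond (x y : ℕ) (p q : RamProg) : RamProg
  /-- `while x < y do p` -/
  | loop (x y : ℕ) (p : RamProg) : RamProg

namespace RamProg

/-- `Exec p σ t τ`: started in the store `σ`, the program `p` halts after exactly `t` steps in
the store `τ`. Every elementary instruction and every evaluation of a test is one step. -/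
inductive Exec : RamProg → RamState → ℕ → RamState → Prop where
  | skip (σ : RamState) : Exec skip σ 1 σ
  | const (σ : RamState) (x : ℕ) (c : ℤ) : Exec (const x c) σ 1 (σ.setVar x c)
  | add (σ : RamState) (x y z : ℕ) :
      Exec (add x y z) σ 1 (σ.setVar x (σ.vars y + σ.vars z))
  | sub (σ : RamState) (x y z : ℕ) :
      Exec (sub x y z) σ 1 (σ.setVar x (σ.vars y - σ.vars z))
  | load (σ : RamState) (x A y : ℕ) :
      Exec (load x A y) σ 1 (σ.setVar x (σ.arr A (σ.vars y)))
  | store (σ : RamState) (A x y : ℕ) :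
      Exec (store A x y) σ 1 (σ.setCell A (σ.vars x) (σ.vars y))
  | seq {p q : RamProg} {σ τ υ : RamState} {t u : ℕ} :
      Exec p σ t τ → Exec q τ u υ → Exec (seq p q) σ (t + u) υ
  | cond_true {x y : ℕ} {p q : RamProg} {σ τ : RamState} {t : ℕ} :
      σ.vars x < σ.vars y → Exec p σ t τ → Exec (cond x y p q) σ (t + 1) τ
  | cond_false {x y : ℕ} {p q : RamProg} {σ τ : RamState} {t : ℕ} :
      ¬ σ.vars x < σ.vars y → Exec q σ t τ → Exec (cond x y p q) σ (t + 1) τ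
  | loop_true {x y : ℕ} {p : RamProg} {σ τ υ : RamState} {t u : ℕ} :
      σ.vars x < σ.vars y → Exec p σ t τ → Exec (loop x y p) τ u υ →
      Exec (loop x y p) σ (t + u + 1) υ
  | loop_false {x y : ℕ} {p : RamProg} {σ : RamState} :
      ¬ σ.vars x < σ.vars y → Exec (loop x y p) σ 1 σ

/-- The machine is deterministic: running time and final store are determined by the program and
the initial store. -/
theorem Exec.deterministic {p : RamProg} {σ τ τ' : RamState} {t t' : ℕ}
    (h : Exec p σ t τ) (h' : Exec p σ t' τ') : t = t' ∧ τ = τ' := by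
  induction h generalizing t' τ' with
  | skip | const | add | sub | load | store => cases h'; exact ⟨rfl, rfl⟩
  | seq _ _ ih1 ih2 =>
    cases h' with
    | seq a b =>
      obtain ⟨rfl, rfl⟩ := ih1 a
      obtain ⟨rfl, rfl⟩ := ih2 b
      exact ⟨rfl, rfl⟩
  | cond_true hc _ ih =>
    cases h' with
    | cond_true _ a => obtain ⟨rfl, rfl⟩ := ih a; exact ⟨rfl, rfl⟩
    | cond_false hn _ => exact absurd hc hn
  | cond_false hn _ ih =>
    cases h' with
    | cond_true hc _ => exact absurd hc hn
    | cond_false _ a => obtain ⟨rfl, rfl⟩ := ih a; exact ⟨rfl, rfl⟩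
  | loop_true hc _ _ ih1 ih2 =>
    cases h' with
    | loop_true _ a b =>
      obtain ⟨rfl, rfl⟩ := ih1 a
      obtain ⟨rfl, rfl⟩ := ih2 b
      exact ⟨rfl, rfl⟩
    | loop_false hn => exact absurd hc hn
  | loop_false hn =>
    cases h' with
    | loop_true hc _ _ => exact absurd hc hn
    | loop_false _ => exact ⟨rfl, rfl⟩

end RamProg

/-- The initial store on input `(k, x₀, …, xₙ₋₁)`: variable `0` holds `k`, variable `1` holds `n`,
cell `i` of array `0` holds `xᵢ` for `0 ≤ i < n`, and everything else is `0`. -/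
def capInput (k : ℕ) (xs : List ℤ) : RamState where
  vars x := if x = 0 then (k : ℤ) else if x = 1 then (xs.length : ℤ) else 0
  arr A i := if A = 0 ∧ 0 ≤ i then xs.getD i.toNat 0 else 0

/-!
Call a progression inside `X` maximal if it cannot be prolonged inside `X`. Since progressions may
overlap, only maximal ones are needed, and such a progression is determined by one of its members
and its difference (`line`). A state of the search is a set `S ⊆ X` covered so far together with the
number `j` of progressions used; a step adds the line through two members `u`, `y` of `X`. Trying
all pairs in every step would take time `n ^ O(k)`. Two observations reduce this to
`2 ^ O(k ^ 2)` states.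

* If at most `k ^ 2` elements are uncovered, all pairs are tried, but only `2 ^ (k ^ 2)` different
  covered sets can follow, and each of them is processed once.
* If more are uncovered, consider the `k ^ 2 + 1` smallest of them. One progression `A` of the
  remaining solution contains more than `k` of these, and two of them are at most `2 ^ k` steps of
  `A` apart (`exists_close_pair`). So only differences `(v - u) / m` with `u`, `v` among the first
  uncovered elements and `1 ≤ m ≤ 2 ^ k` need be tried, which makes `2 ^ O(k)` branches, and there
  are at most `k` such steps in a row. The reason is the theorem of Crittenden and Vanden Eynden
  that `c` residue classes which cover `2 ^ c` consecutive terms of a progression cover the next one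
  too (`exists_dvd_of_window`): if the gap before `w` in `A` is longer than `2 ^ k`, then one of the
  progressions chosen before must end inside this gap, and it can do so in one gap only.

Correctness of the search is `cap_iff_reach`, and the number of states is bounded in
`exists_states_finset`. The program keeps the list of all states found, without repetitions, in one
array and processes them in order; in the end the list is closed under steps, so that it contains
every reachable state (`searchProg_spec`). Specifications of programs are stated with `Runs`, which bounds the number of steps and
describes the final store; what a program leaves unchanged is read off from its text by
`Exec.frame`. All numbers in the time bound are at most `Z = 2 ^ (8 * k ^ 2) * (n + 1)`, and the
bound itself is a polynomial in `Z` (`capProg_time`).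
-/

/-! ### Covering consecutive terms by residue classes -/

open Finset in
/-- If each of the `2 ^ c` consecutive terms `p, p + d, …` of a progression lies in one of `c`
residue classes with nonzero moduli, then so does the next term: with `ζ` a primitive root of unity
of order `δ`, membership in a class is the vanishing of `1 - ζ ^ (x - a)`; the product of these
factors is a sum of `2 ^ c` exponentials in the index and so satisfies a linear recurrence of
order `2 ^ c`. -/
theorem exists_dvd_of_window {ι : Type*} (F : Finset ι) (a δ : ι → ℤ)
    (hδ : ∀ B ∈ F, δ B ≠ 0) (p d : ℤ)
    (h : ∀ i : ℕ, i < 2 ^ F.card → ∃ B ∈ F, δ B ∣ p + i * d - a B) :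
    ∃ B ∈ F, δ B ∣ p + (2 ^ F.card : ℕ) * d - a B := by
  classical
  let ζ : ι → ℂ := fun B => Complex.exp (2 * Real.pi * Complex.I / ((δ B).natAbs : ℕ))
  have hζ : ∀ B ∈ F, IsPrimitiveRoot (ζ B) (δ B).natAbs := fun B hB =>
    Complex.isPrimitiveRoot_exp _ (Int.natAbs_ne_zero.mpr (hδ B hB))
  have hζ0 : ∀ B, ζ B ≠ 0 := fun B => Complex.exp_ne_zero _
  let f : ℕ → ℂ := fun i => ∏ B ∈ F, (1 - ζ B ^ (p - a B) * (ζ B ^ d) ^ i)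
  have hf : ∀ i : ℕ, f i = 0 ↔ ∃ B ∈ F, δ B ∣ p + i * d - a B := by
    intro i
    simp only [f, Finset.prod_eq_zero_iff]
    refine exists_congr fun B => and_congr_right fun hB => ?_
    have e : ζ B ^ (p - a B) * (ζ B ^ d) ^ i = ζ B ^ (p + i * d - a B) := by
      rw [← zpow_natCast, ← zpow_mul, ← zpow_add₀ (hζ0 B)]
      congr 1; ring
    rw [e, sub_eq_zero, eq_comm, (hζ B hB).zpow_eq_one_iff_dvd, Int.natAbs_dvd]
  let c : Finset ι → ℂ := fun S => ∏ B ∈ S, -(ζ B ^ (p - a B))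
  let l : Finset ι → ℂ := fun S => ∏ B ∈ S, ζ B ^ d
  have hexp : ∀ i, f i = ∑ S ∈ F.powerset, c S * l S ^ i := by
    intro i
    have : f i = ∏ B ∈ F, (-(ζ B ^ (p - a B)) * (ζ B ^ d) ^ i + 1) :=
      Finset.prod_congr rfl fun B _ => by ring
    rw [this, Finset.prod_add]
    refine Finset.sum_congr rfl fun S _ => ?_
    simp only [c, l, Finset.prod_const_one, mul_one]
    rw [← Finset.prod_pow, ← Finset.prod_mul_distrib]
  let q : Polynomial ℂ := ∏ S ∈ F.powerset, (Polynomial.X - Polynomial.C (l S))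
  have hq : q.Monic := Polynomial.monic_prod_of_monic _ _ fun S _ => Polynomial.monic_X_sub_C _
  have hdeg : q.natDegree = 2 ^ F.card := by
    simp only [q]
    rw [Polynomial.natDegree_prod_of_monic _ _ fun S _ => Polynomial.monic_X_sub_C _]
    simp
  have hroot : ∀ S ∈ F.powerset, q.eval (l S) = 0 := by
    intro S hS
    simp only [q, Polynomial.eval_prod]
    exact Finset.prod_eq_zero hS (by simp)
  have hrec : ∑ i ∈ range (2 ^ F.card + 1), q.coeff i * f i = 0 := by
    simp_rw [hexp, Finset.mul_sum]
    rw [Finset.sum_comm]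
    refine Finset.sum_eq_zero fun S hS => ?_
    have := hroot S hS
    rw [Polynomial.eval_eq_sum_range, hdeg] at this
    calc _ = c S * ∑ i ∈ range (2 ^ F.card + 1), q.coeff i * l S ^ i := by
          rw [Finset.mul_sum]; exact Finset.sum_congr rfl fun i _ => by ring
      _ = 0 := by rw [this, mul_zero]
  rw [Finset.sum_range_succ, Finset.sum_eq_zero, zero_add, ← hdeg, hq.coeff_natDegree, one_mul,
    hdeg] at hrec
  · exact (hf _).1 hrec
  · intro i hi
    rw [(hf i).2 (h i (Finset.mem_range.1 hi)), mul_zero]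

/-! ### Progressions and maximal progressions -/

theorem apSet_reverse (a d : ℤ) (m : ℕ) : apSet a d m = apSet (a + m * d) (-d) m := by
  ext x
  constructor
  · rintro ⟨i, hi, rfl⟩
    exact ⟨m - i, by omega, by push_cast [hi]; ring⟩
  · rintro ⟨i, hi, rfl⟩
    exact ⟨m - i, by omega, by push_cast [hi]; ring⟩

/-- An element lying between two members of a progression and congruent to its first term modulo
its difference is a member. -/
theorem apSet_convex {a d : ℤ} {m : ℕ} {x z w : ℤ} (hx : x ∈ apSet a d m) (hz : z ∈ apSet a d m)
    (hxw : x < w) (hwz : w ≤ z) (hw : d ∣ w - a) : w ∈ apSet a d m := by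
  obtain ⟨i, hi, rfl⟩ := hx
  obtain ⟨j, hj, rfl⟩ := hz
  obtain ⟨t, ht⟩ := hw
  obtain rfl : w = a + t * d := by linarith
  have h1 : (i : ℤ) * d < t * d := by linarith
  have h2 : t * d ≤ (j : ℤ) * d := by linarith
  have key : 0 ≤ t ∧ t ≤ m := by
    rcases lt_trichotomy d 0 with hd | rfl | hd
    · have := lt_of_mul_lt_mul_of_nonpos_right h1 hd.le
      have := (mul_le_mul_right_of_neg hd).1 h2
      omega
    · simp at h1
    · have := lt_of_mul_lt_mul_of_nonneg_right h1 hd.le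
      have := le_of_mul_le_mul_of_pos_right h2 hd
      omega
  exact ⟨t.toNat, by omega, by rw [Int.toNat_of_nonneg key.1]⟩

/-- The elements `u, u + d, u + 2 d, …` of `X` up to the first one that is missing from `X`. -/
noncomputable def ray (X : Finset ℤ) (u d : ℤ) : Finset ℤ :=
  open Classical in
  X.filter fun x => ∃ j : ℕ, x = u + j * d ∧ ∀ i ≤ j, u + (i : ℤ) * d ∈ X

theorem mem_ray {X : Finset ℤ} {u d x : ℤ} :
    x ∈ ray X u d ↔ ∃ j : ℕ, x = u + j * d ∧ ∀ i ≤ j, u + (i : ℤ) * d ∈ X := by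
  simp only [ray, Finset.mem_filter, and_iff_right_iff_imp]
  rintro ⟨j, rfl, h⟩
  exact h j le_rfl

theorem ray_subset (X : Finset ℤ) (u d : ℤ) : ray X u d ⊆ X := by
  classical exact Finset.filter_subset _ _

/-- The longest progression inside `X` through `u` with difference `d` is the union of two rays. -/
noncomputable def line (X : Finset ℤ) (u d : ℤ) : Finset ℤ := ray X u d ∪ ray X u (-d)

theorem line_subset (X : Finset ℤ) (u d : ℤ) : line X u d ⊆ X :=
  Finset.union_subset (ray_subset _ _ _) (ray_subset _ _ _)

theorem exists_first_missing (X : Finset ℤ) {u d : ℤ} (hd : d ≠ 0) (hu : u ∈ X) :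
    ∃ J : ℕ, (∀ i ≤ J, u + (i : ℤ) * d ∈ X) ∧ u + ((J + 1 : ℕ) : ℤ) * d ∉ X := by
  classical
  have hex : ∃ i : ℕ, u + (i : ℤ) * d ∉ X := by
    by_contra! hall
    have hinj : Function.Injective fun i : ℕ => u + (i : ℤ) * d := by
      intro i j hij
      simpa [hd] using hij
    exact (Set.infinite_range_of_injective hinj)
      (X.finite_toSet.subset (by rintro _ ⟨i, rfl⟩; exact hall i))
  have h0 : Nat.find hex ≠ 0 := by
    intro h
    have := Nat.find_spec hex
    rw [h] at this
    simp [hu] at this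
  obtain ⟨J, hJ⟩ := Nat.exists_eq_succ_of_ne_zero h0
  refine ⟨J, fun i hi => ?_, ?_⟩
  · have := Nat.find_min hex (m := i) (by omega)
    simpa using this
  · have := Nat.find_spec hex
    rwa [hJ] at this

theorem ray_eq_apSet (X : Finset ℤ) {u d : ℤ} (hu : u ∈ X) :
    ∃ J : ℕ, (ray X u d : Set ℤ) = apSet u d J := by
  rcases eq_or_ne d 0 with rfl | hd
  · refine ⟨0, ?_⟩
    ext x
    simp only [Finset.mem_coe, mem_ray, mul_zero, add_zero, apSet, Set.mem_ofPred_eq]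
    exact ⟨fun ⟨j, h, _⟩ => ⟨0, le_rfl, h⟩, fun ⟨j, _, h⟩ => ⟨0, h, fun _ _ => hu⟩⟩
  · obtain ⟨J, h1, h2⟩ := exists_first_missing X hd hu
    refine ⟨J, ?_⟩
    ext x
    simp only [Finset.mem_coe, mem_ray, apSet, Set.mem_ofPred_eq]
    constructor
    · rintro ⟨j, rfl, h⟩
      refine ⟨j, ?_, rfl⟩
      by_contra hj
      exact h2 (h (J + 1) (by omega))
    · rintro ⟨j, hj, rfl⟩
      exact ⟨j, rfl, fun i hi => h1 i (hi.trans hj)⟩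

theorem isAP_line (X : Finset ℤ) {u d : ℤ} (hu : u ∈ X) : IsAP (line X u d : Set ℤ) := by
  obtain ⟨J, hJ⟩ := ray_eq_apSet X (d := d) hu
  obtain ⟨I, hI⟩ := ray_eq_apSet X (d := -d) hu
  refine ⟨u - I * d, d, I + J, ?_⟩
  rw [line, Finset.coe_union, hJ, hI]
  ext x
  constructor
  · rintro (⟨i, hi, rfl⟩ | ⟨i, hi, rfl⟩)
    · exact ⟨I + i, by omega, by push_cast; ring⟩
    · exact ⟨I - i, by omega, by push_cast [hi]; ring⟩
  · rintro ⟨i, hi, rfl⟩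
    rcases le_total I i with h | h
    · exact Or.inl ⟨i - I, by omega, by push_cast [h]; ring⟩
    · exact Or.inr ⟨I - i, by omega, by push_cast [h]; ring⟩

/-- A progression inside `X` is contained in the longest one through any of its members. -/
theorem apSet_subset_line {X : Finset ℤ} {a d : ℤ} {m : ℕ} (hA : apSet a d m ⊆ X) {u : ℤ}
    (hu : u ∈ apSet a d m) : apSet a d m ⊆ line X u d := by
  obtain ⟨s, hs, rfl⟩ := hu
  rintro _ ⟨t, ht, rfl⟩
  simp only [line, Finset.coe_union, Set.mem_union, Finset.mem_coe, mem_ray]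
  rcases le_total s t with h | h
  · exact Or.inl ⟨t - s, by push_cast [h]; ring,
      fun i hi => hA ⟨s + i, by omega, by push_cast; ring⟩⟩
  · exact Or.inr ⟨s - t, by push_cast [h]; ring,
      fun i hi => hA ⟨s - i, by omega, by push_cast [show i ≤ s by omega]; ring⟩⟩

/-! ### The states of the search -/

/-- The `k ^ 2 + 1` smallest elements of `X \ S` (all of them, if there are fewer). -/
def firstUncovered (k : ℕ) (X S : Finset ℤ) : Finset ℤ :=
  (X \ S).filter fun u => ((X \ S).filter (· < u)).card ≤ k ^ 2

/-- The pairs `(u, y)` for which the search extends the covered set `S` by the line through `u` and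
`y`: arbitrary pairs if at most `k ^ 2` elements are uncovered, and otherwise only those for which
`u` and some term `u + m (y - u)` with `1 ≤ m ≤ 2 ^ k` are among the first uncovered elements. -/
def Allowed (k : ℕ) (X S : Finset ℤ) (u y : ℤ) : Prop :=
  (X \ S).card ≤ k ^ 2 ∨
    ∃ m : ℕ, m < 2 ^ k ∧ u ∈ firstUncovered k X S ∧
      u + ((m + 1 : ℕ) : ℤ) * (y - u) ∈ firstUncovered k X S

/-- The set covered after adding the line through `u` and `y`; for `y = u` this line is `{u}`. -/
noncomputable def child (X S : Finset ℤ) (u y : ℤ) : Finset ℤ := S ∪ line X u (y - u)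

/-- The states `(S, j)` visited by the search: `S` is the set covered by the `j` lines added
so far. -/
inductive Reach (k : ℕ) (X : Finset ℤ) : Finset ℤ → ℕ → Prop
  | init : Reach k X ∅ 0
  | step {S : Finset ℤ} {j : ℕ} {u y : ℤ} : Reach k X S j → j < k → u ∈ X → y ∈ X →
      Allowed k X S u y → Reach k X (child X S u y) (j + 1)

theorem Reach.subset {k : ℕ} {X S : Finset ℤ} {j : ℕ} (h : Reach k X S j) : S ⊆ X := by
  induction h with
  | init => exact Finset.empty_subset _
  | step _ _ _ _ _ ih => exact Finset.union_subset ih (line_subset _ _ _)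

theorem Reach.le {k : ℕ} {X S : Finset ℤ} {j : ℕ} (h : Reach k X S j) : j ≤ k := by
  induction h with
  | init => exact Nat.zero_le _
  | step _ hj _ _ _ _ => exact hj

theorem Reach.exists_cover {k : ℕ} {X S : Finset ℤ} {j : ℕ} (h : Reach k X S j) :
    ∃ s : Fin j → Set ℤ, (∀ i, IsAP (s i) ∧ s i ⊆ X) ∧ (⋃ i, s i) = S := by
  induction h with
  | init => exact ⟨fun i => i.elim0, fun i => i.elim0, by simp⟩
  | @step S j u y _ _ hu hy _ ih =>
    obtain ⟨s, hs, hS⟩ := ih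
    refine ⟨Fin.snoc (α := fun _ => Set ℤ) s (line X u (y - u) : Set ℤ), fun i => ?_, ?_⟩
    · refine Fin.lastCases ?_ (fun i => ?_) i
      · rw [Fin.snoc_last]
        exact ⟨isAP_line X hu, by exact_mod_cast line_subset X u _⟩
      · rw [Fin.snoc_castSucc]
        exact hs i
    · rw [child, Finset.coe_union, ← hS]
      ext x
      simp only [Set.mem_iUnion, Set.mem_union]
      constructor
      · rintro ⟨i, hi⟩
        revert hi
        refine Fin.lastCases (fun hi => ?_) (fun i hi => ?_) i
        · rw [Fin.snoc_last] at hi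
          exact Or.inr hi
        · rw [Fin.snoc_castSucc] at hi
          exact Or.inl ⟨i, hi⟩
      · rintro (⟨i, hi⟩ | hi)
        · exact ⟨i.castSucc, by rwa [Fin.snoc_castSucc]⟩
        · exact ⟨Fin.last j, by rwa [Fin.snoc_last]⟩

/-- The ranks of the elements of a finite set are `0, 1, …, U.card - 1`. -/
theorem image_rank (U : Finset ℤ) :
    U.image (fun u => (U.filter (· < u)).card) = Finset.range U.card := by
  have hinj : Set.InjOn (fun u => (U.filter (· < u)).card) (U : Set ℤ) := by
    have key : ∀ u ∈ U, ∀ v, u < v → (U.filter (· < u)).card < (U.filter (· < v)).card := by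
      intro u hu v huv
      refine Finset.card_lt_card (Finset.ssubset_iff_of_subset ?_ |>.2 ⟨u, ?_, ?_⟩)
      · intro x hx
        simp only [Finset.mem_filter] at hx ⊢
        exact ⟨hx.1, hx.2.trans huv⟩
      · simp [hu, huv]
      · simp
    intro u hu v hv huv
    rcases lt_trichotomy u v with h | h | h
    · exact absurd huv (key u hu v h).ne
    · exact h
    · exact absurd huv (key v hv u h).ne'
  refine Finset.eq_of_subset_of_card_le ?_ ?_
  · intro x hx
    obtain ⟨u, hu, rfl⟩ := Finset.mem_image.1 hx
    refine Finset.mem_range.2 (Finset.card_lt_card ((Finset.filter_ssubset).2 ⟨u, hu, by simp⟩))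
  · rw [Finset.card_range, Finset.card_image_of_injOn hinj]

theorem card_firstUncovered_le (k : ℕ) (X S : Finset ℤ) :
    (firstUncovered k X S).card ≤ k ^ 2 + 1 := by
  have hinj : Set.InjOn (fun u => ((X \ S).filter (· < u)).card) ((X \ S : Finset ℤ) : Set ℤ) := by
    rw [← Finset.card_image_iff, image_rank, Finset.card_range]
  rw [← Finset.card_range (k ^ 2 + 1)]
  refine Finset.card_le_card_of_injOn _ (fun u hu => ?_)
    (hinj.mono (by exact_mod_cast Finset.filter_subset _ _))
  exact Finset.mem_coe.2 (Finset.mem_range.2 (Nat.lt_succ_of_le (Finset.mem_filter.1 hu).2))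

theorem lt_card_firstUncovered {k : ℕ} {X S : Finset ℤ} (h : k ^ 2 < (X \ S).card) :
    k ^ 2 < (firstUncovered k X S).card := by
  have : Finset.range (k ^ 2 + 1) ⊆
      (firstUncovered k X S).image fun u => ((X \ S).filter (· < u)).card := by
    intro i hi
    have hi' := Finset.mem_range.1 hi
    have : i ∈ (X \ S).image fun u => ((X \ S).filter (· < u)).card := by
      rw [image_rank]; exact Finset.mem_range.2 (by omega)
    obtain ⟨u, hu, rfl⟩ := Finset.mem_image.1 this
    exact Finset.mem_image.2 ⟨u, Finset.mem_filter.2 ⟨hu, by omega⟩, rfl⟩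
  have := (Finset.card_le_card this).trans Finset.card_image_le
  rw [Finset.card_range] at this
  omega

theorem firstUncovered_of_lt {k : ℕ} {X S : Finset ℤ} {u v : ℤ} (hu : u ∈ firstUncovered k X S)
    (hv : v ∈ X \ S) (h : v < u) : v ∈ firstUncovered k X S := by
  refine Finset.mem_filter.2 ⟨hv, (Finset.card_le_card ?_).trans (Finset.mem_filter.1 hu).2⟩
  intro x hx
  simp only [Finset.mem_filter] at hx ⊢
  exact ⟨hx.1, hx.2.trans h⟩

/-! ### The search finds a solution if there is one -/

/-- Suppose `w` is uncovered, but the `2 ^ k` terms before it of a progression with positive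
difference are covered by at most `k` progressions. Then one of these has a member among those
terms and ends before `w`. For otherwise, those that meet the window all extend beyond `w`, and
`w` lies in the residue class of one of them by `exists_dvd_of_window`, hence in it. -/
theorem exists_ending_before {k : ℕ} {C : Finset (Set ℤ)} (hC : ∀ B ∈ C, IsAP B)
    (hk : C.card ≤ k) {w d : ℤ} (hd : 0 < d) (hw : ∀ B ∈ C, w ∉ B)
    (hcov : ∀ i : ℕ, 1 ≤ i → i ≤ 2 ^ k → ∃ B ∈ C, w - i * d ∈ B) :
    ∃ B ∈ C, (∃ i : ℕ, 1 ≤ i ∧ i ≤ 2 ^ k ∧ w - i * d ∈ B) ∧ ∀ x ∈ B, x < w := by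
  classical
  by_contra! hcon
  choose! a δ m hB using hC
  -- The members of `C` that meet the window; by assumption each of them reaches `w` or beyond.
  let F := C.filter fun B => ∃ i : ℕ, 1 ≤ i ∧ i ≤ 2 ^ k ∧ w - i * d ∈ B
  have hF : ∀ B ∈ F, B ∈ C ∧ ∃ x ∈ apSet (a B) (δ B) (m B), ∃ z ∈ apSet (a B) (δ B) (m B),
      x < w ∧ w ≤ z := by
    intro B hBF
    obtain ⟨hBC, i, h1, h2, hi⟩ := Finset.mem_filter.1 hBF
    obtain ⟨z, hz, hwz⟩ := hcon B hBC ⟨i, h1, h2, hi⟩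
    rw [hB B hBC] at hi hz
    have : 0 < (i : ℤ) * d := by positivity
    exact ⟨hBC, _, hi, z, hz, by linarith, hwz⟩
  have hFk : 2 ^ F.card ≤ 2 ^ k :=
    Nat.pow_le_pow_right (by norm_num) ((Finset.card_filter_le _ _).trans hk)
  -- Only the last `2 ^ F.card` terms of the window are needed. A progression in `F` has members on
  -- both sides of `w`, so its difference is not zero.
  obtain ⟨B, hBF, hdvd⟩ := exists_dvd_of_window F a δ (fun B hBF h0 => by
      obtain ⟨-, x, ⟨i, -, rfl⟩, z, ⟨j, -, rfl⟩, h1, h2⟩ := hF B hBF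
      rw [h0] at h1 h2
      simp only [mul_zero] at h1 h2
      linarith) (w - (2 ^ F.card : ℕ) * d) d (fun i hi => by
      obtain ⟨B, hBC, hi'⟩ := hcov (2 ^ F.card - i) (by omega) (by omega)
      have hBF : B ∈ F := Finset.mem_filter.2 ⟨hBC, _, by omega, by omega, hi'⟩
      refine ⟨B, hBF, ?_⟩
      rw [hB B hBC] at hi'
      obtain ⟨t, -, ht⟩ := hi'
      rw [Nat.cast_sub hi.le] at ht
      exact ⟨t, by linarith⟩)
  rw [sub_add_cancel] at hdvd
  obtain ⟨hBC, x, hx, z, hz, h1, h2⟩ := hF B hBF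
  apply hw B hBC
  rw [hB B hBC]
  exact apSet_convex hx hz h1 h2 hdvd

/-- If a progression `A` with positive difference contains more than `C.card + 1` of the smallest
elements that the progressions in `C` leave uncovered, then two of these are at most `2 ^ k` steps
of `A` apart. Otherwise each of them except the least has a member of `C` ending in the gap
of `A` before it, and distinct gaps give distinct members of `C`. -/
theorem exists_close_pair {k : ℕ} {X S : Finset ℤ} {C : Finset (Set ℤ)} (hC : ∀ B ∈ C, IsAP B)
    (hk : C.card ≤ k) (hS : ∀ x ∈ X, x ∈ S ↔ ∃ B ∈ C, x ∈ B) {a d : ℤ} {m : ℕ} (hd : 0 < d)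
    (hA : apSet a d m ⊆ X) {W : Finset ℤ}
    (hW : ∀ x, x ∈ W ↔ x ∈ firstUncovered k X S ∧ x ∈ apSet a d m) (hcard : C.card + 1 < W.card) :
    ∃ u ∈ W, ∃ i < 2 ^ k, u + ((i + 1 : ℕ) : ℤ) * d ∈ W := by
  classical
  by_contra! hcon
  have hUS : ∀ x ∈ W, x ∈ X ∧ x ∉ S := fun x hx =>
    Finset.mem_sdiff.1 (Finset.mem_filter.1 ((hW x).1 hx).1).1
  have hne : W.Nonempty := Finset.card_pos.1 (by omega)
  have key : ∀ w ∈ W.erase (W.min' hne), ∃ B ∈ C,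
      (∃ x ∈ B, ∀ v ∈ W, v < w → v < x) ∧ ∀ x ∈ B, x < w := by
    intro w hw
    obtain ⟨hwne, hwW⟩ := Finset.mem_erase.1 hw
    have hlow : (W.filter (· < w)).Nonempty :=
      ⟨_, Finset.mem_filter.2 ⟨W.min'_mem hne, lt_of_le_of_ne (W.min'_le w hwW) hwne.symm⟩⟩
    obtain ⟨p, hp, hpmax⟩ := (W.filter (· < w)).exists_max_image id hlow
    obtain ⟨hpW, hpw⟩ := Finset.mem_filter.1 hp
    obtain ⟨s, hs, hps⟩ := ((hW p).1 hpW).2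
    obtain ⟨t, ht, hwt⟩ := ((hW w).1 hwW).2
    have hst : s < t := by
      have : (s : ℤ) * d < t * d := by linarith
      exact_mod_cast lt_of_mul_lt_mul_of_nonneg_right this hd.le
    -- `p` is the member of `W` before `w`. An uncovered term of the gap between them would be among
    -- the first uncovered elements as well, so the whole gap is covered by `C`.
    have hlong : 2 ^ k < t - s := by
      by_contra! hle
      refine hcon p hpW (t - s - 1) (by omega) ?_
      rw [show t - s - 1 + 1 = t - s by omega, Nat.cast_sub hst.le]
      convert hwW using 1
      rw [hps, hwt]; ring
    have hpx : ∀ i : ℕ, 1 ≤ i → i ≤ 2 ^ k → p < w - i * d ∧ w - i * d < w := by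
      intro i h1 h2
      have h3 : (i : ℤ) + 1 ≤ t - s := by omega
      have h4 : ((i : ℤ) + 1) * d ≤ (t - s) * d := mul_le_mul_of_nonneg_right h3 hd.le
      have h5 : 0 < (i : ℤ) * d := by positivity
      constructor <;> linarith
    obtain ⟨B, hBC, ⟨i, h1, h2, hi⟩, hBw⟩ := exists_ending_before hC hk hd
      (fun B hBC hwB => (hUS w hwW).2 ((hS w (hUS w hwW).1).2 ⟨B, hBC, hwB⟩)) (w := w)
      (fun i h1 h2 => by
        have hiA : w - i * d ∈ apSet a d m :=
          ⟨t - i, by omega, by rw [Nat.cast_sub (by omega), hwt]; ring⟩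
        have hiX : w - i * d ∈ X := hA hiA
        refine (hS _ hiX).1 ?_
        by_contra hiS
        have hiW : w - i * d ∈ W := (hW _).2
          ⟨firstUncovered_of_lt ((hW w).1 hwW).1 (Finset.mem_sdiff.2 ⟨hiX, hiS⟩) (hpx i h1 h2).2,
            hiA⟩
        have := hpmax _ (Finset.mem_filter.2 ⟨hiW, (hpx i h1 h2).2⟩)
        exact absurd (hpx i h1 h2).1 (not_lt.2 this))
    refine ⟨B, hBC, ⟨_, hi, fun v hv hvw => ?_⟩, hBw⟩
    exact (hpmax v (Finset.mem_filter.2 ⟨hv, hvw⟩)).trans_lt (hpx i h1 h2).1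
  choose! g hgC hgx hgw using key
  have hinj : Set.InjOn g (W.erase (W.min' hne)) := by
    have aux : ∀ v ∈ W.erase (W.min' hne), ∀ w ∈ W.erase (W.min' hne), v < w → g v ≠ g w := by
      intro v hv w hw hvw h
      obtain ⟨x, hx, hxv⟩ := hgx w hw
      rw [← h] at hx
      exact lt_asymm (hxv v (Finset.mem_of_mem_erase hv) hvw) (hgw v hv x hx)
    intro v hv w hw h
    rcases lt_trichotomy v w with hlt | heq | hlt
    · exact absurd h (aux v hv w hw hlt)
    · exact heq
    · exact absurd h.symm (aux w hw v hv hlt)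
  have := Finset.card_le_card_of_injOn g (fun w hw => hgC w hw) hinj
  rw [Finset.card_erase_of_mem (W.min'_mem hne)] at this
  omega

/-- One step of the search follows any solution: among the remaining progressions there is one that
the search can add. -/
theorem exists_allowed {k j : ℕ} {X S : Finset ℤ} {C R : Finset (Set ℤ)}
    (hC : ∀ B ∈ C, IsAP B) (hCj : C.card ≤ j) (hS : ∀ x ∈ X, x ∈ S ↔ ∃ B ∈ C, x ∈ B)
    (hR : ∀ A ∈ R, IsAP A ∧ A ⊆ X) (hRj : j + R.card ≤ k)
    (hcov : ∀ x ∈ X, x ∉ S → ∃ A ∈ R, x ∈ A) (hXS : (X \ S).Nonempty) :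
    ∃ A ∈ R, ∃ u ∈ X, ∃ y ∈ X, Allowed k X S u y ∧ A ⊆ line X u (y - u) := by
  classical
  have hRpos : 0 < R.card := by
    obtain ⟨x, hx⟩ := hXS
    obtain ⟨A, hA, -⟩ := hcov x (Finset.mem_sdiff.1 hx).1 (Finset.mem_sdiff.1 hx).2
    exact Finset.card_pos.2 ⟨A, hA⟩
  by_cases hsmall : (X \ S).card ≤ k ^ 2
  · obtain ⟨A, hA⟩ := Finset.card_pos.1 hRpos
    obtain ⟨⟨a, d, m, rfl⟩, hAX⟩ := hR A hA
    have ha : a ∈ apSet a d m := ⟨0, Nat.zero_le _, by simp⟩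
    refine ⟨_, hA, a, hAX ha, ?_⟩
    rcases Nat.eq_zero_or_pos m with rfl | hm
    · -- A progression with one term may be stated with any difference; here it has to be `0`.
      refine ⟨a, hAX ha, Or.inl hsmall, ?_⟩
      have : apSet a d 0 = apSet a (a - a) 0 := by
        ext x; simp [apSet]
      rw [this]
      rw [this] at hAX ha
      exact apSet_subset_line hAX ha
    · refine ⟨a + d, hAX ⟨1, hm, by simp⟩, Or.inl hsmall, ?_⟩
      rw [add_sub_cancel_left]
      exact apSet_subset_line hAX ha
  · push Not at hsmall
    have hpig : ∃ A ∈ R, k < ((firstUncovered k X S).filter (· ∈ A)).card := by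
      by_contra! hle
      have hsub : firstUncovered k X S ⊆
          R.biUnion fun A => (firstUncovered k X S).filter (· ∈ A) := by
        intro x hx
        obtain ⟨hxX, hxS⟩ := Finset.mem_sdiff.1 (Finset.mem_filter.1 hx).1
        obtain ⟨A, hA, hxA⟩ := hcov x hxX hxS
        exact Finset.mem_biUnion.2 ⟨A, hA, Finset.mem_filter.2 ⟨hx, hxA⟩⟩
      have h1 := (Finset.card_le_card hsub).trans (Finset.card_biUnion_le_card_mul _ _ _ hle)
      have h2 := lt_card_firstUncovered hsmall
      have h3 : R.card * k ≤ k * k := Nat.mul_le_mul_right _ (by omega)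
      rw [pow_two] at h2
      omega
    obtain ⟨A, hA, hlt⟩ := hpig
    obtain ⟨⟨a, d, m, rfl⟩, hAX⟩ := hR A hA
    have hd0 : d ≠ 0 := by
      rintro rfl
      have : ((firstUncovered k X S).filter (· ∈ apSet a 0 m)).card ≤ 1 := by
        refine Finset.card_le_one.2 fun x hx z hz => ?_
        obtain ⟨_, _, hx'⟩ := (Finset.mem_filter.1 hx).2
        obtain ⟨_, _, hz'⟩ := (Finset.mem_filter.1 hz).2
        simp_all
      omega
    refine ⟨_, hA, ?_⟩
    generalize hAA : apSet a d m = A at hA hAX hlt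
    obtain ⟨a, d, hd, rfl⟩ : ∃ a' d' : ℤ, 0 < d' ∧ A = apSet a' d' m := by
      rcases lt_or_gt_of_ne hd0 with h | h
      · exact ⟨a + m * d, -d, by omega, by rw [← hAA, apSet_reverse]⟩
      · exact ⟨a, d, h, hAA.symm⟩
    obtain ⟨u, hu, i, hi, hv⟩ := exists_close_pair hC (show C.card ≤ k by omega) hS hd hAX
      (W := (firstUncovered k X S).filter (· ∈ apSet a d m)) (fun x => Finset.mem_filter)
      (by omega)
    obtain ⟨hu1, hu2⟩ := Finset.mem_filter.1 hu
    obtain ⟨hv1, hv2⟩ := Finset.mem_filter.1 hv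
    have hy : u + d ∈ apSet a d m := by
      obtain ⟨s, hs, rfl⟩ := hu2
      obtain ⟨t, ht, hst⟩ := hv2
      have : ((s + (i + 1) : ℕ) : ℤ) * d = t * d := by push_cast at hst ⊢; linarith
      have := mul_right_cancel₀ hd.ne' this
      exact ⟨s + 1, by omega, by push_cast; ring⟩
    refine ⟨u, hAX hu2, u + d, hAX hy, Or.inr ⟨i, hi, hu1, ?_⟩, ?_⟩
    · rwa [add_sub_cancel_left]
    · rw [add_sub_cancel_left]
      exact apSet_subset_line hAX hu2

/-- If the progressions in `C` have been chosen so far and those in `R` complete a solution, then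
the search reaches a state in which everything is covered. -/
theorem Reach.exists_full {k : ℕ} {X : Finset ℤ} (R : Finset (Set ℤ)) :
    ∀ {S : Finset ℤ} {j : ℕ} {C : Finset (Set ℤ)}, Reach k X S j →
      (∀ B ∈ C, IsAP B) → C.card ≤ j → (∀ x ∈ X, x ∈ S ↔ ∃ B ∈ C, x ∈ B) →
      (∀ A ∈ R, IsAP A ∧ A ⊆ X) → j + R.card ≤ k → (∀ x ∈ X, x ∉ S → ∃ A ∈ R, x ∈ A) →
      ∃ S' j', Reach k X S' j' ∧ X \ S' = ∅ := by
  classical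
  induction hr : R.card generalizing R with
  | zero =>
    intro S j C h _ _ _ _ _ hcov
    refine ⟨S, j, h, ?_⟩
    rw [Finset.card_eq_zero] at hr
    subst hr
    ext x
    simp only [Finset.mem_sdiff, Finset.notMem_empty, iff_false]
    rintro ⟨hx, hxS⟩
    obtain ⟨A, hA, -⟩ := hcov x hx hxS
    simp at hA
  | succ r ih =>
    intro S j C h hC hCj hS hR hRj hcov
    rcases (X \ S).eq_empty_or_nonempty with hE | hN
    · exact ⟨S, j, h, hE⟩
    obtain ⟨A, hA, u, hu, y, hy, hal, hAl⟩ :=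
      exists_allowed (k := k) hC hCj hS hR (by omega) hcov hN
    refine ih (R.erase A) (by rw [Finset.card_erase_of_mem hA]; omega)
      (h.step (by omega) hu hy hal) (C := insert (line X u (y - u) : Set ℤ) C)
      ?_ ((Finset.card_insert_le _ _).trans (Nat.succ_le_succ hCj)) ?_
      (fun B hB => hR B (Finset.mem_of_mem_erase hB)) (by omega) ?_
    · intro B hB
      rcases Finset.mem_insert.1 hB with rfl | hB
      · exact isAP_line X hu
      · exact hC B hB
    · intro x hx
      simp only [child, Finset.mem_union, hS x hx, Finset.exists_mem_insert,
        Finset.mem_coe, or_comm]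
    · intro x hx hxS
      simp only [child, Finset.mem_union, not_or] at hxS
      obtain ⟨A', hA', hxA'⟩ := hcov x hx hxS.1
      refine ⟨A', Finset.mem_erase.2 ⟨?_, hA'⟩, hxA'⟩
      rintro rfl
      exact hxS.2 (by exact_mod_cast hAl hxA')

/-- The search is a correct decision procedure. -/
theorem cap_iff_reach {k : ℕ} {X : Finset ℤ} :
    CAP (X : Set ℤ) k ↔ ∃ S j, Reach k X S j ∧ X \ S = ∅ := by
  classical
  constructor
  · rintro ⟨j, hj, s, hs, hX⟩
    refine Reach.exists_full (Finset.univ.image s) Reach.init (C := ∅) (by simp) le_rfl (by simp)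
      ?_ ?_ ?_
    · intro A hA
      obtain ⟨i, -, rfl⟩ := Finset.mem_image.1 hA
      exact hs i
    · rw [zero_add]
      exact Finset.card_image_le.trans (by simpa using hj)
    · intro x hx _
      rw [← Finset.mem_coe, ← hX] at hx
      obtain ⟨i, hi⟩ := Set.mem_iUnion.1 hx
      exact ⟨s i, Finset.mem_image_of_mem _ (Finset.mem_univ i), hi⟩
  · rintro ⟨S, j, h, hE⟩
    obtain ⟨s, hs, hS⟩ := h.exists_cover
    refine ⟨j, h.le, s, hs, ?_⟩
    rw [hS, Finset.coe_inj]
    exact h.subset.antisymm (Finset.sdiff_eq_empty_iff_subset.1 hE)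

/-! ### The number of states -/

/-- A superset of the states reached by `i` restricted branchings. -/
noncomputable def branchStates (k : ℕ) (X : Finset ℤ) : ℕ → Finset (Finset ℤ)
  | 0 => {∅}
  | i + 1 => (branchStates k X i).biUnion fun S =>
      (firstUncovered k X S ×ˢ firstUncovered k X S ×ˢ Finset.range (2 ^ k)).image fun p =>
        S ∪ line X p.1 ((p.2.1 - p.1) / ((p.2.2 + 1 : ℕ) : ℤ))

theorem card_branchStates_le (k : ℕ) (X : Finset ℤ) (i : ℕ) :
    (branchStates k X i).card ≤ ((k ^ 2 + 1) * ((k ^ 2 + 1) * 2 ^ k)) ^ i := by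
  induction i with
  | zero => simp [branchStates]
  | succ i ih =>
    rw [branchStates, pow_succ]
    refine (Finset.card_biUnion_le_card_mul _ _ _ fun S _ => ?_).trans (Nat.mul_le_mul_right _ ih)
    refine Finset.card_image_le.trans ?_
    rw [Finset.card_product, Finset.card_product, Finset.card_range]
    have := card_firstUncovered_le k X S
    gcongr

/-- A reachable state arises by restricted branchings only, or else has an ancestor of this kind
with at most `k ^ 2` uncovered elements. -/
theorem Reach.exists_branchState {k : ℕ} {X S : Finset ℤ} {j : ℕ} (h : Reach k X S j) :
    ∃ i ≤ j, ∃ R ∈ branchStates k X i, R ⊆ S ∧ (S = R ∨ (X \ R).card ≤ k ^ 2) := by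
  induction h with
  | init => exact ⟨0, le_rfl, ∅, by simp [branchStates], le_rfl, Or.inl rfl⟩
  | @step S j u y hr _ _ _ hal ih =>
    obtain ⟨i, hi, R, hR, hRS, hor⟩ := ih
    by_cases hsmall : (X \ R).card ≤ k ^ 2
    · exact ⟨i, by omega, R, hR, hRS.trans Finset.subset_union_left, Or.inr hsmall⟩
    · obtain rfl := hor.resolve_right hsmall
      obtain ⟨m, hm, hu, hv⟩ := hal.resolve_left hsmall
      refine ⟨i + 1, by omega, child X S u y, ?_, le_rfl, Or.inl rfl⟩
      rw [branchStates]
      refine Finset.mem_biUnion.2 ⟨S, hR, Finset.mem_image.2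
        ⟨(u, u + ((m + 1 : ℕ) : ℤ) * (y - u), m), by simpa using ⟨hu, hv, hm⟩, ?_⟩⟩
      simp only [child, add_sub_cancel_left]
      rw [Int.mul_ediv_cancel_left _ (by positivity)]

theorem states_bound (k : ℕ) :
    (k + 1) * (((k ^ 2 + 1) * ((k ^ 2 + 1) * 2 ^ k)) ^ k * 2 ^ k ^ 2) * (k + 1) ≤
      2 ^ (8 * k ^ 2) := by
  have h1 : k + 1 ≤ 2 ^ k := Nat.lt_two_pow_self
  have h2 : k ≤ k ^ 2 := by nlinarith [Nat.zero_le k, sq_nonneg k, Nat.le_self_pow two_ne_zero k]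
  have h3 : k ^ 2 + 1 ≤ 2 ^ (2 * k) := by
    calc k ^ 2 + 1 ≤ (k + 1) ^ 2 := by nlinarith
      _ ≤ (2 ^ k) ^ 2 := Nat.pow_le_pow_left h1 2
      _ = _ := by rw [← pow_mul, mul_comm]
  have h4 : k + 1 ≤ 2 ^ k ^ 2 := h1.trans (Nat.pow_le_pow_right (by norm_num) h2)
  calc _ ≤ 2 ^ k ^ 2 * ((2 ^ (2 * k) * (2 ^ (2 * k) * 2 ^ k)) ^ k * 2 ^ k ^ 2) * 2 ^ k ^ 2 := by
        gcongr
    _ = 2 ^ (8 * k ^ 2) := by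
        simp only [← pow_add, ← pow_mul]
        congr 1; ring

/-- Up to the first state with at most `k ^ 2` uncovered elements the search branches in at most
`2 ^ (5 * k)` ways, and such a state has at most `2 ^ k ^ 2` descendants for each count. -/
theorem exists_states_finset (k : ℕ) (X : Finset ℤ) :
    ∃ V : Finset (Finset ℤ × ℕ), V.card ≤ 2 ^ (8 * k ^ 2) ∧
      ∀ S j, Reach k X S j → (S, j) ∈ V := by
  classical
  let D : Finset ℤ → Finset (Finset ℤ) := fun R =>
    if (X \ R).card ≤ k ^ 2 then (X \ R).powerset.image (R ∪ ·) else {R}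
  have hD : ∀ R, (D R).card ≤ 2 ^ k ^ 2 := by
    intro R
    simp only [D]
    split_ifs with h
    · refine Finset.card_image_le.trans ?_
      rw [Finset.card_powerset]
      exact Nat.pow_le_pow_right (by norm_num) h
    · simpa using Nat.one_le_two_pow
  refine ⟨((Finset.range (k + 1)).biUnion fun i => (branchStates k X i).biUnion D) ×ˢ
    Finset.range (k + 1), ?_, ?_⟩
  · refine le_trans ?_ (states_bound k)
    rw [Finset.card_product, Finset.card_range]
    refine Nat.mul_le_mul_right _ ?_
    refine (Finset.card_biUnion_le_card_mul _ _
      (((k ^ 2 + 1) * ((k ^ 2 + 1) * 2 ^ k)) ^ k * 2 ^ k ^ 2) fun i hi => ?_).trans ?_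
    · refine (Finset.card_biUnion_le_card_mul _ _ _ fun R _ => hD R).trans ?_
      refine Nat.mul_le_mul_right _ ((card_branchStates_le k X i).trans ?_)
      exact Nat.pow_le_pow_right (by positivity) (by have := Finset.mem_range.1 hi; omega)
    · rw [Finset.card_range]
  · intro S j h
    have hj := h.le
    obtain ⟨i, hi, R, hR, hRS, hor⟩ := h.exists_branchState
    refine Finset.mem_product.2 ⟨Finset.mem_biUnion.2 ⟨i, Finset.mem_range.2 (by omega),
      Finset.mem_biUnion.2 ⟨R, hR, ?_⟩⟩, Finset.mem_range.2 (by simp; omega)⟩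
    simp only [D]
    split_ifs with hc
    · exact Finset.mem_image.2 ⟨S \ R, Finset.mem_powerset.2
        (Finset.sdiff_subset_sdiff h.subset le_rfl), Finset.union_sdiff_of_subset hRS⟩
    · exact Finset.mem_singleton.2 (hor.resolve_right hc)

/-! ### Reasoning about programs and their running time -/

namespace RamState

@[simp] theorem setVar_vars (σ : RamState) (x y : ℕ) (v : ℤ) :
    (σ.setVar x v).vars y = if y = x then v else σ.vars y := by
  simp [setVar, Function.update_apply]

@[simp] theorem setVar_arr (σ : RamState) (x : ℕ) (v : ℤ) : (σ.setVar x v).arr = σ.arr := rfl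

@[simp] theorem setCell_vars (σ : RamState) (A : ℕ) (i v : ℤ) :
    (σ.setCell A i v).vars = σ.vars := rfl

@[simp] theorem setCell_arr (σ : RamState) (A B : ℕ) (i j v : ℤ) :
    (σ.setCell A i v).arr B j = if B = A ∧ j = i then v else σ.arr B j := by
  by_cases h : B = A
  · subst h; simp [setCell, Function.update_apply]
  · simp [setCell, h]

end RamState

namespace RamProg

/-- Whether the program has an instruction assigning variable `y`. -/
def writesVar (y : ℕ) : RamProg → Bool
  | skip => false
  | const x _ => x == y
  | add x _ _ => x == y
  | sub x _ _ => x == y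
  | load x _ _ => x == y
  | store _ _ _ => false
  | seq p q => p.writesVar y || q.writesVar y
  | cond _ _ p q => p.writesVar y || q.writesVar y
  | loop _ _ p => p.writesVar y

/-- Whether the program has an instruction writing to array `B`. -/
def writesArr (B : ℕ) : RamProg → Bool
  | store A _ _ => A == B
  | seq p q => p.writesArr B || q.writesArr B
  | cond _ _ p q => p.writesArr B || q.writesArr B
  | loop _ _ p => p.writesArr B
  | _ => false

/-- The stores `σ` and `τ` agree wherever `p` does not write. -/
structure Frame (p : RamProg) (σ τ : RamState) : Prop where
  vars : ∀ x, p.writesVar x = false → τ.vars x = σ.vars x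
  arr : ∀ A, p.writesArr A = false → τ.arr A = σ.arr A

theorem Frame.refl (p : RamProg) (σ : RamState) : Frame p σ σ :=
  ⟨fun _ _ => rfl, fun _ _ => rfl⟩

theorem Frame.trans {p : RamProg} {σ τ υ : RamState} (h : Frame p σ τ) (h' : Frame p τ υ) :
    Frame p σ υ :=
  ⟨fun x hx => (h'.vars x hx).trans (h.vars x hx), fun A hA => (h'.arr A hA).trans (h.arr A hA)⟩

theorem Frame.weaken {p q : RamProg} {σ τ : RamState} (h : Frame p σ τ)
    (hv : ∀ x, q.writesVar x = false → p.writesVar x = false)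
    (ha : ∀ A, q.writesArr A = false → p.writesArr A = false) : Frame q σ τ :=
  ⟨fun x hx => h.vars x (hv x hx), fun A hA => h.arr A (ha A hA)⟩

theorem Exec.frame {p : RamProg} {σ τ : RamState} {t : ℕ} (h : Exec p σ t τ) : Frame p σ τ := by
  induction h with
  | skip | loop_false => exact Frame.refl _ _
  | const | add | sub | load =>
    refine ⟨fun y hy => ?_, fun _ _ => rfl⟩
    simp only [writesVar, beq_eq_false_iff_ne, ne_eq] at hy
    rw [RamState.setVar_vars, if_neg (Ne.symm hy)]
  | store =>
    refine ⟨fun _ _ => rfl, fun B hB => ?_⟩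
    simp only [writesArr, beq_eq_false_iff_ne, ne_eq] at hB
    funext j
    rw [RamState.setCell_arr, if_neg (fun h => hB h.1.symm)]
  | seq _ _ ih1 ih2 =>
    exact (ih1.weaken (by simp +contextual [writesVar]) (by simp +contextual [writesArr])).trans
      (ih2.weaken (by simp +contextual [writesVar]) (by simp +contextual [writesArr]))
  | cond_true _ _ ih | cond_false _ _ ih =>
    exact ih.weaken (by simp +contextual [writesVar]) (by simp +contextual [writesArr])
  | loop_true _ _ _ ih1 ih2 =>
    exact (ih1.weaken (by simp [writesVar]) (by simp [writesArr])).trans ih2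

/-- Started in `σ`, the program halts within `T` steps in a store satisfying `Q`. -/
def Runs (p : RamProg) (σ : RamState) (T : ℕ) (Q : RamState → Prop) : Prop :=
  ∃ t τ, Exec p σ t τ ∧ t ≤ T ∧ Q τ

theorem Runs.mono {p : RamProg} {σ : RamState} {T T' : ℕ} {Q Q' : RamState → Prop}
    (h : Runs p σ T Q) (hT : T ≤ T') (hQ : ∀ τ, Frame p σ τ → Q τ → Q' τ) : Runs p σ T' Q' := by
  obtain ⟨t, τ, he, ht, hq⟩ := h
  exact ⟨t, τ, he, ht.trans hT, hQ τ he.frame hq⟩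

theorem Runs.seq {p q : RamProg} {σ : RamState} {T T' : ℕ} {Q Q' : RamState → Prop}
    (h : Runs p σ T Q) (h' : ∀ τ, Frame p σ τ → Q τ → Runs q τ T' Q') :
    Runs (seq p q) σ (T + T') Q' := by
  obtain ⟨t, τ, he, ht, hq⟩ := h
  obtain ⟨t', τ', he', ht', hq'⟩ := h' τ he.frame hq
  exact ⟨_, τ', he.seq he', Nat.add_le_add ht ht', hq'⟩

theorem Runs.cond {x y : ℕ} {p q : RamProg} {σ : RamState} {T : ℕ} {Q : RamState → Prop}
    (h : σ.vars x < σ.vars y → Runs p σ T Q) (h' : ¬ σ.vars x < σ.vars y → Runs q σ T Q) :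
    Runs (cond x y p q) σ (T + 1) Q := by
  by_cases hc : σ.vars x < σ.vars y
  · obtain ⟨t, τ, he, ht, hq⟩ := h hc
    exact ⟨_, τ, he.cond_true hc, Nat.succ_le_succ ht, hq⟩
  · obtain ⟨t, τ, he, ht, hq⟩ := h' hc
    exact ⟨_, τ, he.cond_false hc, Nat.succ_le_succ ht, hq⟩

/-- Rule for loops with an invariant that carries a decreasing measure. -/
theorem Runs.loop {x y : ℕ} {p : RamProg} {T : ℕ} (I : ℕ → RamState → Prop)
    (hp : ∀ m σ, I m σ → σ.vars x < σ.vars y → Runs p σ T fun τ => ∃ m' < m, I m' τ) :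
    ∀ m σ, I m σ → Runs (loop x y p) σ (m * (T + 1) + 1)
      fun τ => (∃ m', I m' τ) ∧ ¬ τ.vars x < τ.vars y := by
  intro m
  induction m using Nat.strong_induction_on with
  | _ m ih =>
    intro σ hσ
    by_cases hc : σ.vars x < σ.vars y
    · obtain ⟨t, τ, he, ht, m', hm', hτ⟩ := hp m σ hσ hc
      obtain ⟨t', τ', he', ht', hq⟩ := ih m' hm' τ hτ
      refine ⟨_, τ', he.loop_true hc he', ?_, hq⟩
      have : (m' + 1) * (T + 1) ≤ m * (T + 1) := Nat.mul_le_mul_right _ hm'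
      linarith
    · exact ⟨1, σ, Exec.loop_false hc, by omega, ⟨m, hσ⟩, hc⟩

/-- `for i = 0, …, n - 1 do p`, where variable `2` holds the constant `1`. -/
def forLoop (i n : ℕ) (p : RamProg) : RamProg :=
  seq (const i 0) (loop i n (seq p (add i i 2)))

/-- Rule for counting loops with an invariant `I`. The invariant need not mention what `p`
leaves unchanged, as it may be assumed that the current store agrees there with the initial one. -/
theorem Runs.forLoop {i n : ℕ} {p : RamProg} {σ : RamState} {T N : ℕ} (I : ℕ → RamState → Prop)
    (hN : σ.vars n = N) (h2 : σ.vars 2 = 1) (hi : p.writesVar i = false)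
    (hn : (p.forLoop i n).writesVar n = false) (hp2 : (p.forLoop i n).writesVar 2 = false)
    (h0 : I 0 (σ.setVar i 0))
    (hstep : ∀ j < N, ∀ τ, Frame (p.forLoop i n) σ τ → τ.vars i = j → I j τ →
      Runs p τ T fun τ' => I (j + 1) (τ'.setVar i ((j + 1 : ℕ) : ℤ))) :
    Runs (p.forLoop i n) σ (N * (T + 2) + 2) (I N) := by
  have hF0 : Frame (p.forLoop i n) σ (σ.setVar i 0) :=
    (Exec.const σ i 0).frame.weaken (by simp +contextual [RamProg.forLoop, writesVar])
      (by simp +contextual [RamProg.forLoop, writesArr])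
  have hrun := Runs.loop (x := i) (y := n) (p := RamProg.seq p (RamProg.add i i 2)) (T := T + 1)
    (fun m τ => m ≤ N ∧ Frame (p.forLoop i n) σ τ ∧ τ.vars i = (N - m : ℕ) ∧ I (N - m) τ)
    (fun m τ ⟨hm, hF, hv, hI⟩ hlt => by
      rw [hv, hF.vars n hn, hN] at hlt
      have hlt' : N - m < N := by exact_mod_cast hlt
      obtain ⟨t, υ, he, ht, hq⟩ := hstep _ hlt' τ hF hv hI
      have hvi : υ.vars i + υ.vars 2 = ((N - m + 1 : ℕ) : ℤ) := by
        have hp2' : p.writesVar 2 = false := by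
          simp only [RamProg.forLoop, writesVar, Bool.or_eq_false_iff] at hp2
          exact hp2.2.1
        rw [he.frame.vars i hi, he.frame.vars 2 hp2', hv, hF.vars 2 hp2, h2]
        push_cast
        rfl
      have he' := he.seq (Exec.add υ i i 2)
      refine ⟨_, _, he', by omega, m - 1, by omega, by omega, hF.trans (he'.frame.weaken ?_ ?_),
        ?_, ?_⟩
      · simp +contextual [RamProg.forLoop, writesVar]
      · simp +contextual [RamProg.forLoop, writesArr]
      · rw [RamState.setVar_vars, if_pos rfl, hvi]
        congr 1; omega
      · rw [hvi, show N - (m - 1) = N - m + 1 by omega]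
        exact hq) N (σ.setVar i 0)
    ⟨le_rfl, hF0, by rw [RamState.setVar_vars, if_pos rfl, Nat.sub_self]; rfl, by
      rw [Nat.sub_self]; exact h0⟩
  obtain ⟨t, τ, he, ht, ⟨m, hm, hF, hv, hI⟩, hlt⟩ := hrun
  rw [hv, hF.vars n hn, hN, not_lt] at hlt
  have hm0 : N - m = N := by
    have : N ≤ N - m := by exact_mod_cast hlt
    omega
  rw [hm0] at hI
  refine ⟨_, τ, (Exec.const σ i 0).seq he, ?_, hI⟩
  have : N * (T + 1 + 1) = N * (T + 2) := rfl
  omega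

/-- Programs without loops. -/
def loopFree : RamProg → Bool
  | seq p q => p.loopFree && q.loopFree
  | cond _ _ p q => p.loopFree && q.loopFree
  | loop _ _ _ => false
  | _ => true

/-- The final store of a loop-free program. -/
@[simp] def eval : RamProg → RamState → RamState
  | skip, σ => σ
  | const x c, σ => σ.setVar x c
  | add x y z, σ => σ.setVar x (σ.vars y + σ.vars z)
  | sub x y z, σ => σ.setVar x (σ.vars y - σ.vars z)
  | load x A y, σ => σ.setVar x (σ.arr A (σ.vars y))
  | store A x y, σ => σ.setCell A (σ.vars x) (σ.vars y)
  | seq p q, σ => q.eval (p.eval σ)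
  | cond x y p q, σ => if σ.vars x < σ.vars y then p.eval σ else q.eval σ
  | loop _ _ _, σ => σ

/-- An upper bound for the running time of a loop-free program. -/
def cost : RamProg → ℕ
  | seq p q => p.cost + q.cost
  | cond _ _ p q => max p.cost q.cost + 1
  | _ => 1

theorem Runs.of_eval {p : RamProg} {σ : RamState} {Q : RamState → Prop} (hp : p.loopFree = true)
    (hQ : Q (p.eval σ)) : Runs p σ p.cost Q := by
  suffices h : ∃ t, Exec p σ t (p.eval σ) ∧ t ≤ p.cost by
    obtain ⟨t, h1, h2⟩ := h
    exact ⟨t, _, h1, h2, hQ⟩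
  clear hQ
  induction p generalizing σ with
  | skip => exact ⟨1, Exec.skip σ, le_rfl⟩
  | const x c => exact ⟨1, Exec.const σ x c, le_rfl⟩
  | add x y z => exact ⟨1, Exec.add σ x y z, le_rfl⟩
  | sub x y z => exact ⟨1, Exec.sub σ x y z, le_rfl⟩
  | load x A y => exact ⟨1, Exec.load σ x A y, le_rfl⟩
  | store A x y => exact ⟨1, Exec.store σ A x y, le_rfl⟩
  | seq p q ihp ihq =>
    simp only [loopFree, Bool.and_eq_true] at hp
    obtain ⟨t, h1, h2⟩ := ihp hp.1 (σ := σ)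
    obtain ⟨u, h3, h4⟩ := ihq hp.2 (σ := p.eval σ)
    exact ⟨_, h1.seq h3, Nat.add_le_add h2 h4⟩
  | cond x y p q ihp ihq =>
    simp only [loopFree, Bool.and_eq_true] at hp
    simp only [eval, cost]
    split_ifs with hc
    · obtain ⟨t, h1, h2⟩ := ihp hp.1 (σ := σ)
      exact ⟨_, h1.cond_true hc, by omega⟩
    · obtain ⟨t, h1, h2⟩ := ihq hp.2 (σ := σ)
      exact ⟨_, h1.cond_false hc, by omega⟩
  | loop => simp [loopFree] at hp

end RamProg

open RamProg

/-! ### The invariant part of the store -/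

/-- What holds throughout the computation: variable `0` holds `k`, `1` holds `n`, `2` and `3` hold
the constants `1` and `0`, `4` holds the threshold `k ^ 2 + 1`, `5` holds `2 ^ k`, `10` holds the
length `n + 1` of a row (the membership vector of a set and a count), and array `0` holds the
input. -/
structure Env (k n : ℕ) (x : ℕ → ℤ) (σ : RamState) : Prop where
  v0 : σ.vars 0 = k
  v1 : σ.vars 1 = n
  v2 : σ.vars 2 = 1
  v3 : σ.vars 3 = 0
  v4 : σ.vars 4 = (k ^ 2 + 1 : ℕ)
  v5 : σ.vars 5 = (2 ^ k : ℕ)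
  v10 : σ.vars 10 = (n + 1 : ℕ)
  input : ∀ i < n, σ.arr 0 (i : ℕ) = x i

theorem Env.frame {k n : ℕ} {x : ℕ → ℤ} {p : RamProg} {σ τ : RamState} (h : Env k n x σ)
    (hF : Frame p σ τ)
    (hp : (p.writesVar 0 || p.writesVar 1 || p.writesVar 2 || p.writesVar 3 || p.writesVar 4 ||
      p.writesVar 5 || p.writesVar 10 || p.writesArr 0) = false) : Env k n x τ := by
  simp only [Bool.or_eq_false_iff] at hp
  obtain ⟨⟨⟨⟨⟨⟨⟨h0, h1⟩, h2⟩, h3⟩, h4⟩, h5⟩, h10⟩, hA⟩ := hp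
  constructor
  · rw [hF.vars _ h0, h.v0]
  · rw [hF.vars _ h1, h.v1]
  · rw [hF.vars _ h2, h.v2]
  · rw [hF.vars _ h3, h.v3]
  · rw [hF.vars _ h4, h.v4]
  · rw [hF.vars _ h5, h.v5]
  · rw [hF.vars _ h10, h.v10]
  · rw [hF.arr _ hA]; exact h.input

/-- The first `n` cells of `f` hold the indicator of `{i | x i ∈ S}`. -/
def IsRow (n : ℕ) (x : ℕ → ℤ) (f : ℤ → ℤ) (S : Set ℤ) : Prop :=
  ∀ i < n, (x i ∈ S → f (i : ℕ) = 1) ∧ (x i ∉ S → f (i : ℕ) = 0)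

/-! ### Copying a row -/

/-- Copy a row from array `A` at the offset in variable `a` to array `B` at the offset in
variable `b`. -/
def copyProg (A a B b : ℕ) : RamProg :=
  forLoop 12 10 (seq (add 13 a 12) (seq (load 14 A 13) (seq (add 13 b 12) (store B 13 14))))

theorem copyProg_spec {A a B b n : ℕ} {σ : RamState} {oa ob : ℤ} (h10 : σ.vars 10 = (n + 1 : ℕ))
    (h2 : σ.vars 2 = 1) (ha : σ.vars a = oa) (hb : σ.vars b = ob) (hAB : B ≠ A)
    (hwa : (copyProg A a B b).writesVar a = false) (hwb : (copyProg A a B b).writesVar b = false) :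
    Runs (copyProg A a B b) σ ((n + 1) * 6 + 2) fun τ => ∀ c : ℤ,
      τ.arr B c = if ob ≤ c ∧ c < ob + (n + 1 : ℕ) then σ.arr A (oa + (c - ob)) else σ.arr B c := by
  have hab : a ≠ 12 ∧ a ≠ 13 ∧ a ≠ 14 ∧ b ≠ 12 ∧ b ≠ 13 ∧ b ≠ 14 := by
    simp [copyProg, RamProg.forLoop, writesVar] at hwa hwb
    omega
  refine Runs.forLoop (fun j τ => ∀ c : ℤ, τ.arr B c = if ob ≤ c ∧ c < ob + (j : ℕ) then
    σ.arr A (oa + (c - ob)) else σ.arr B c) h10 h2 rfl rfl rfl ?_ ?_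
  · intro c
    rw [if_neg (by simp)]
    rfl
  · intro j hj τ hF hi hI
    refine Runs.of_eval (p := seq _ _) rfl ?_
    have hA : τ.arr A = σ.arr A := hF.arr A (by simp [RamProg.forLoop, writesArr, hAB])
    have hva : τ.vars a = oa := (hF.vars a hwa).trans ha
    have hvb : τ.vars b = ob := (hF.vars b hwb).trans hb
    intro c
    simp [hab, hi, hva, hvb, hI, hA]
    by_cases hc : c = ob + j
    · subst hc
      simp
    · simp only [hc, if_false]
      refine if_congr ?_ rfl rfl
      omega

/-! ### Counting the uncovered elements -/

/-- As the input has no repetitions, uncovered elements may be counted by their indices. -/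
theorem card_uncovered {n : ℕ} {x : ℕ → ℤ} (hx : Set.InjOn x (Finset.range n)) (S : Finset ℤ)
    (q : ℤ → Prop) [DecidablePred q] :
    ((((Finset.range n).image x) \ S).filter q).card =
      ((Finset.range n).filter fun i => x i ∉ S ∧ q (x i)).card := by
  rw [← Finset.card_image_of_injOn (s := (Finset.range n).filter fun i => x i ∉ S ∧ q (x i))
    (f := x) (hx.mono (by simp +contextual [Set.subset_def]))]
  congr 1
  ext u
  simp only [Finset.mem_filter, Finset.mem_sdiff, Finset.mem_image]
  constructor
  · rintro ⟨⟨⟨i, hi, rfl⟩, hS⟩, hq⟩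
    exact ⟨i, ⟨hi, hS, hq⟩, rfl⟩
  · rintro ⟨i, ⟨hi, hS, hq⟩, rfl⟩
    exact ⟨⟨⟨i, hi, rfl⟩, hS⟩, hq⟩

/-- Count in variable `16` the elements that are not covered by the row in array `3`. -/
def countProg : RamProg :=
  seq (const 16 0) (forLoop 15 1 (seq (load 22 3 15) (cond 22 2 (add 16 16 2) skip)))

theorem countProg_spec {k n : ℕ} {x : ℕ → ℤ} {σ : RamState} {S : Finset ℤ}
    (hx : Set.InjOn x (Finset.range n)) (hE : Env k n x σ) (hS : IsRow n x (σ.arr 3) S) :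
    Runs countProg σ (1 + (n * 5 + 2)) fun τ =>
      τ.vars 16 = (((Finset.range n).image x \ S).card : ℕ) := by
  refine Runs.seq (Runs.of_eval (Q := fun τ => τ.vars 16 = 0) rfl (by simp)) fun τ hF h16 => ?_
  have hE' := hE.frame hF rfl
  refine (Runs.forLoop (fun j υ => υ.vars 16 = ((Finset.range j).filter fun i => x i ∉ S).card)
    hE'.v1 hE'.v2 rfl rfl rfl (by simpa using h16) ?_).mono le_rfl ?_
  · intro j hj υ hF' hi hI
    refine Runs.of_eval rfl ?_
    have h3 : υ.arr 3 = σ.arr 3 := (hF'.arr 3 rfl).trans (hF.arr 3 rfl)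
    have h2 : υ.vars 2 = 1 := (hF'.vars 2 rfl).trans hE'.v2
    rw [Finset.range_add_one, Finset.filter_insert]
    by_cases hj' : x j ∈ S
    · simp [hi, h3, h2, (hS j hj).1 hj', hj', hI]
    · simp [hi, h3, h2, (hS j hj).2 hj', hj', hI]
  · intro υ _ h
    have := card_uncovered hx S fun _ => True
    simp only [Finset.filter_true, and_true] at this
    rw [this]; exact h

/-! ### Marking the first uncovered elements -/

/-- Count in variable `19` the uncovered elements below the one with index in variable `17`. -/
def rankProg : RamProg :=
  seq (const 19 0) (seq (load 20 0 17) (forLoop 18 1 (seq (load 22 3 18) (cond 22 2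
    (seq (load 21 0 18) (cond 21 20 (add 19 19 2) skip)) skip))))

theorem rankProg_spec {k n : ℕ} {x : ℕ → ℤ} {σ : RamState} {S : Finset ℤ}
    (hx : Set.InjOn x (Finset.range n)) (hE : Env k n x σ) (hS : IsRow n x (σ.arr 3) S)
    {a : ℕ} (ha : a < n) (h17 : σ.vars 17 = a) :
    Runs rankProg σ (1 + (1 + (n * 7 + 2))) fun τ =>
      τ.vars 19 = ((((Finset.range n).image x \ S).filter (· < x a)).card : ℕ) := by
  refine Runs.seq (Runs.of_eval (Q := fun τ => τ.vars 19 = 0) rfl (by simp)) fun τ hF h19 => ?_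
  refine Runs.seq (Runs.of_eval (Q := fun τ => τ.vars 19 = 0 ∧ τ.vars 20 = x a) rfl ?_)
    fun υ hF' ⟨h19, h20⟩ => ?_
  · simp [h19, hF.vars 17 rfl, h17, hF.arr 0 rfl, hE.input a ha]
  have hE' := (hE.frame hF rfl).frame hF' rfl
  refine (Runs.forLoop (fun j υ => υ.vars 19 =
    ((Finset.range j).filter fun i => x i ∉ S ∧ x i < x a).card)
    hE'.v1 hE'.v2 rfl rfl rfl (by simpa using h19) ?_).mono le_rfl ?_
  · intro j hj ρ hFρ hi hI
    refine Runs.of_eval rfl ?_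
    have h3 : ρ.arr 3 = σ.arr 3 := (hFρ.arr 3 rfl).trans ((hF'.arr 3 rfl).trans (hF.arr 3 rfl))
    have h0 : ρ.arr 0 j = x j := by rw [hFρ.arr 0 rfl]; exact hE'.input j hj
    have h2 : ρ.vars 2 = 1 := (hFρ.vars 2 rfl).trans hE'.v2
    have h20' : ρ.vars 20 = x a := (hFρ.vars 20 rfl).trans h20
    rw [Finset.range_add_one, Finset.filter_insert]
    by_cases hj' : x j ∈ S
    · simp [hi, h3, h2, (hS j hj).1 hj', hj', hI]
    · by_cases hlt : x j < x a
      · simp [hi, h3, h2, (hS j hj).2 hj', hj', hI, h0, h20', hlt]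
      · simp [hi, h3, h2, (hS j hj).2 hj', hj', hI, h0, h20', hlt]
  · intro υ _ h
    rw [card_uncovered hx S]
    exact h

/-- Store in array `2` the indicator of the first uncovered elements. -/
def markProg : RamProg :=
  forLoop 17 1 (seq rankProg (seq (load 22 3 17) (seq (const 23 0) (seq
    (cond 22 2 (cond 19 4 (const 23 1) skip) skip) (store 2 17 23)))))

theorem markProg_spec {k n : ℕ} {x : ℕ → ℤ} {σ : RamState} {S : Finset ℤ}
    (hx : Set.InjOn x (Finset.range n)) (hE : Env k n x σ) (hS : IsRow n x (σ.arr 3) S) :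
    Runs markProg σ (n * (1 + (1 + (n * 7 + 2)) + 6 + 2) + 2) fun τ =>
      IsRow n x (τ.arr 2) (firstUncovered k ((Finset.range n).image x) S) := by
  refine Runs.forLoop (fun j τ => IsRow j x (τ.arr 2)
    (firstUncovered k ((Finset.range n).image x) S)) hE.v1 hE.v2 rfl rfl rfl
    (fun i hi => absurd hi (Nat.not_lt_zero i)) ?_
  intro j hj τ hF hi hI
  have hE' := hE.frame hF rfl
  have hS' : IsRow n x (τ.arr 3) S := by rw [hF.arr 3 rfl]; exact hS
  refine Runs.seq (rankProg_spec hx hE' hS' hj hi) fun υ hF' h19 => ?_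
  have hE'' := hE'.frame hF' rfl
  refine Runs.of_eval (p := seq _ _) rfl ?_
  have h17 : υ.vars 17 = j := (hF'.vars 17 rfl).trans hi
  have h3 : υ.arr 3 = τ.arr 3 := hF'.arr 3 rfl
  have h2 : υ.arr 2 = τ.arr 2 := hF'.arr 2 rfl
  have hmem : x j ∈ firstUncovered k ((Finset.range n).image x) S ↔ x j ∉ S ∧
      ((((Finset.range n).image x \ S).filter (· < x j)).card ≤ k ^ 2) := by
    simp only [firstUncovered, Finset.mem_filter, Finset.mem_sdiff, and_congr_left_iff,
      and_iff_right_iff_imp]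
    exact fun _ _ => Finset.mem_image_of_mem x (Finset.mem_range.2 hj)
  intro i hi'
  rcases Nat.lt_succ_iff_lt_or_eq.1 hi' with hlt | rfl
  · have hne : (i : ℤ) ≠ j := by omega
    by_cases c1 : τ.arr 3 j < 1
    · by_cases c2 : υ.vars 19 < υ.vars 4
      · simpa [h17, h3, h2, hE''.v2, c1, c2, hne] using hI i hlt
      · simpa [h17, h3, h2, hE''.v2, c1, c2, hne] using hI i hlt
    · simpa [h17, h3, h2, hE''.v2, c1, hne] using hI i hlt
  · rw [Finset.mem_coe, hmem]
    by_cases c1 : x i ∈ S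
    · simp [h17, h3, (hS' i hj).1 c1, hE''.v2, c1]
    · by_cases c2 : (((Finset.range n).image x \ S).filter (· < x i)).card ≤ k ^ 2
      · have c3 : υ.vars 19 < υ.vars 4 := by rw [h19, hE''.v4]; exact_mod_cast Nat.lt_succ_of_le c2
        simp [h17, h3, (hS' i hj).2 c1, hE''.v2, c1, c2, c3]
      · have c3 : ¬ υ.vars 19 < υ.vars 4 := by
          rw [h19, hE''.v4]; intro h; exact c2 (Nat.le_of_lt_succ (by exact_mod_cast h))
        simp [h17, h3, (hS' i hj).2 c1, hE''.v2, c1, c2, c3]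

/-! ### Testing whether a pair is allowed -/

/-- With `z` in variable `29`, set the flag `27` if `z` is marked and variable `28`, the mark of
the element with index in variable `25`, is `1`. -/
def hitProg : RamProg :=
  forLoop 32 1 (seq (load 33 0 32) (cond 33 29 skip (cond 29 33 skip (seq (load 34 2 32)
    (seq (add 34 34 28) (cond 2 34 (const 27 1) skip))))))

theorem hitProg_spec {k n : ℕ} {x : ℕ → ℤ} {σ : RamState} {F : Finset ℤ} {u : ℤ}
    (hE : Env k n x σ) (hF : IsRow n x (σ.arr 2) F) (hsub : F ⊆ (Finset.range n).image x)
    (h28 : σ.vars 28 = if u ∈ F then 1 else 0) :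
    Runs hitProg σ (n * 9 + 2) fun τ =>
      (0 < τ.vars 27 ↔ 0 < σ.vars 27 ∨ u ∈ F ∧ σ.vars 29 ∈ F) := by
  refine (Runs.forLoop (fun j τ => (0 < τ.vars 27 ↔ 0 < σ.vars 27 ∨
    u ∈ F ∧ ∃ i < j, x i = σ.vars 29 ∧ x i ∈ F)) hE.v1 hE.v2 rfl rfl rfl (by simp) ?_).mono
    le_rfl ?_
  · intro j hj τ hFr hi hI
    refine Runs.of_eval rfl ?_
    have h0 : τ.arr 0 j = x j := by rw [hFr.arr 0 rfl]; exact hE.input j hj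
    have h2 : τ.arr 2 = σ.arr 2 := hFr.arr 2 rfl
    have h29 : τ.vars 29 = σ.vars 29 := hFr.vars 29 rfl
    have h28' : τ.vars 28 = σ.vars 28 := hFr.vars 28 rfl
    have hv2 : τ.vars 2 = 1 := (hFr.vars 2 rfl).trans hE.v2
    have hsplit : (∃ i < j + 1, x i = σ.vars 29 ∧ x i ∈ F) ↔
        (∃ i < j, x i = σ.vars 29 ∧ x i ∈ F) ∨ (x j = σ.vars 29 ∧ x j ∈ F) := by
      simp only [Nat.lt_succ_iff_lt_or_eq, or_and_right, exists_or, exists_eq_left]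
    rw [hsplit]
    rcases lt_trichotomy (x j) (σ.vars 29) with h | h | h
    · simp [hi, h0, h29, h, hI, h.ne]
    · by_cases hu : u ∈ F
      · by_cases hv : x j ∈ F
        · have hv' : σ.vars 29 ∈ F := h ▸ hv
          simp [hi, h0, h29, h, hv2, h28', h28, hu, h2, (hF j hj).1 hv, hv']
        · have hv' : σ.vars 29 ∉ F := h ▸ hv
          simp [hi, h0, h29, h, hv2, h28', h28, hu, h2, (hF j hj).2 hv, hI, hv']
      · by_cases hv : x j ∈ F
        · simp [hi, h0, h29, h, hv2, h28', h28, hu, h2, (hF j hj).1 hv, hI]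
        · simp [hi, h0, h29, h, hv2, h28', h28, hu, h2, (hF j hj).2 hv, hI]
    · simp [hi, h0, h29, h, hI, h.ne', h.not_gt]
  · intro τ _ h
    rw [h]
    refine or_congr_right (and_congr_right fun _ => ⟨?_, fun hz => ?_⟩)
    · rintro ⟨i, -, hi, hF⟩
      exact hi ▸ hF
    · obtain ⟨i, hi, hx⟩ := Finset.mem_image.1 (hsub hz)
      exact ⟨i, Finset.mem_range.1 hi, hx, hx ▸ hz⟩

/-- For the elements `u`, `y` with indices in variables `25` and `26`, store `u` in variables `29`
and `35`, its mark in variable `28` and `y - u` in variable `30`, and set the flag `27` if few elements are uncovered. -/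
def pairProg : RamProg :=
  seq (const 27 0) (seq (cond 16 4 (const 27 1) skip) (seq (load 28 2 25) (seq (load 29 0 25)
    (seq (load 35 0 25) (seq (load 36 0 26) (sub 30 36 35))))))

/-- Set the flag `27` if the elements with indices in variables `25` and `26` form an allowed
pair. -/
def allowedProg : RamProg :=
  seq pairProg (forLoop 31 5 (seq (add 29 29 30) hitProg))

theorem firstUncovered_subset (k : ℕ) (X S : Finset ℤ) : firstUncovered k X S ⊆ X :=
  (Finset.filter_subset _ _).trans Finset.sdiff_subset

theorem allowedProg_spec {k n : ℕ} {x : ℕ → ℤ} {σ : RamState} {S : Finset ℤ} {a b : ℕ}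
    (hE : Env k n x σ) (ha : a < n) (hb : b < n) (h25 : σ.vars 25 = a) (h26 : σ.vars 26 = b)
    (h16 : σ.vars 16 = (((Finset.range n).image x \ S).card : ℕ))
    (hM : IsRow n x (σ.arr 2) (firstUncovered k ((Finset.range n).image x) S)) :
    Runs allowedProg σ (8 + (2 ^ k * (1 + (n * 9 + 2) + 2) + 2)) fun τ =>
      (0 < τ.vars 27 ↔ Allowed k ((Finset.range n).image x) S (x a) (x b)) ∧
      τ.vars 35 = x a ∧ τ.vars 30 = x b - x a := by
  set X := (Finset.range n).image x
  set F := firstUncovered k X S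
  have hpair : Runs pairProg σ 8 fun τ => (0 < τ.vars 27 ↔ (X \ S).card ≤ k ^ 2) ∧
      τ.vars 28 = (if x a ∈ F then 1 else 0) ∧ τ.vars 29 = x a ∧ τ.vars 35 = x a ∧
      τ.vars 30 = x b - x a := by
    refine Runs.of_eval rfl ?_
    have hc : σ.vars 16 < σ.vars 4 ↔ (X \ S).card ≤ k ^ 2 := by
      rw [h16, hE.v4, Nat.cast_lt, Nat.lt_succ_iff]
    have h2 : σ.arr 2 a = if x a ∈ F then 1 else 0 := by
      split_ifs with h
      · exact (hM a ha).1 h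
      · exact (hM a ha).2 h
    by_cases h : σ.vars 16 < σ.vars 4
    · have h' := hc.1 h
      simp [pairProg, h, h', h25, h26, h2, hE.input a ha, hE.input b hb]
    · have h' := fun h' => h (hc.2 h')
      simp [pairProg, h, h25, h26, h2, hE.input a ha, hE.input b hb]
      exact not_le.1 h'
  refine Runs.seq hpair fun τ hF ⟨h27, h28, h29, h35, h30⟩ => ?_
  have hE' := hE.frame hF rfl
  refine (Runs.forLoop (fun m υ => (0 < υ.vars 27 ↔ (X \ S).card ≤ k ^ 2 ∨ ∃ i < m, x a ∈ F ∧
    x a + ((i + 1 : ℕ) : ℤ) * (x b - x a) ∈ F) ∧ υ.vars 29 = x a + m * (x b - x a))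
    hE'.v5 hE'.v2 rfl rfl rfl (by simp [h27, h29]) ?_).mono le_rfl ?_
  · intro m hm υ hF' hi ⟨hI, hI29⟩
    have hE'' := hE'.frame hF' rfl
    refine Runs.seq (Runs.of_eval (Q := fun ρ => ρ.vars 27 = υ.vars 27 ∧
      ρ.vars 29 = x a + ((m + 1 : ℕ) : ℤ) * (x b - x a)) rfl ?_) fun ρ hF'' ⟨h27', h29'⟩ => ?_
    · have : υ.vars 30 = x b - x a := (hF'.vars 30 rfl).trans h30
      simp [hI29, this]
      ring
    · refine (hitProg_spec (hE''.frame hF'' rfl) (F := F) (u := x a) ?_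
        (firstUncovered_subset _ _ _) ?_).mono le_rfl ?_
      · rw [hF''.arr 2 rfl, hF'.arr 2 rfl, hF.arr 2 rfl]
        exact hM
      · rw [hF''.vars 28 rfl, hF'.vars 28 rfl, h28]
      · intro θ hFθ hθ
        refine ⟨?_, ?_⟩
        · have hsplit : (∃ i < m + 1, x a ∈ F ∧ x a + ((i + 1 : ℕ) : ℤ) * (x b - x a) ∈ F) ↔
              (∃ i < m, x a ∈ F ∧ x a + ((i + 1 : ℕ) : ℤ) * (x b - x a) ∈ F) ∨
              (x a ∈ F ∧ x a + ((m + 1 : ℕ) : ℤ) * (x b - x a) ∈ F) := by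
            simp only [Nat.lt_succ_iff_lt_or_eq, or_and_right, exists_or, exists_eq_left]
          rw [hsplit, ← or_assoc, ← hI, ← h27', ← h29', ← hθ]
          simp
        · rw [← h29', ← hFθ.vars 29 rfl]
          simp
  · intro υ hF' ⟨h, _⟩
    exact ⟨h, (hF'.vars 35 rfl).trans h35, (hF'.vars 30 rfl).trans h30⟩

/-! ### Adding a ray -/

/-- Add to the row in array `4` the ray from variable `29` with difference in variable `30`. Every
outer pass whose starting value of variable `29` belongs to the input advances that variable. -/
def rayProg : RamProg :=
  forLoop 37 1 (forLoop 38 1 (seq (load 39 0 38) (cond 39 29 skip (cond 29 39 skip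
    (seq (store 4 38 2) (add 29 29 30))))))

/-- The invariant of `rayProg`: the first `q` elements of the ray have been added. -/
def RayInv (n : ℕ) (x : ℕ → ℤ) (S : Set ℤ) (u d : ℤ) (q : ℕ) (τ : RamState) : Prop :=
  τ.vars 29 = u + q * d ∧ (∀ i < q, u + (i : ℤ) * d ∈ (Finset.range n).image x) ∧
    IsRow n x (τ.arr 4) (S ∪ {y | ∃ i < q, y = u + ((i : ℕ) : ℤ) * d})

/-- The ray is complete once its next element is missing from the input, or after `n` steps: these
use up all `n` elements unless the difference is `0`. -/
theorem eq_ray_of_complete {n : ℕ} {x : ℕ → ℤ} {u d : ℤ} {q : ℕ}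
    (hu : u ∈ (Finset.range n).image x) (hq : ∀ i < q, u + (i : ℤ) * d ∈ (Finset.range n).image x)
    (hdone : n ≤ q ∨ u + (q : ℤ) * d ∉ (Finset.range n).image x) :
    {y : ℤ | ∃ i < q, y = u + ((i : ℕ) : ℤ) * d} = ray ((Finset.range n).image x) u d := by
  ext y
  rw [Finset.mem_coe, mem_ray]
  constructor
  · rintro ⟨i, hi, rfl⟩
    exact ⟨i, rfl, fun j hj => hq j (by omega)⟩
  · rintro ⟨j, rfl, hj⟩
    by_contra hcon
    have hqj : q ≤ j := by
      by_contra h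
      exact hcon ⟨j, by omega, rfl⟩
    have hnq := hdone.resolve_right fun h => h (hj q hqj)
    have hn : 0 < n := by
      obtain ⟨i, hi, -⟩ := Finset.mem_image.1 hu
      exact Nat.pos_of_ne_zero fun h => by simp [h] at hi
    rcases eq_or_ne d 0 with rfl | hd
    · exact hcon ⟨0, by omega, by simp⟩
    · have hsub : (Finset.range (q + 1)).image (fun i : ℕ => u + (i : ℤ) * d) ⊆
          (Finset.range n).image x := by
        intro z hz
        obtain ⟨i, hi, rfl⟩ := Finset.mem_image.1 hz
        exact hj i (by have := Finset.mem_range.1 hi; omega)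
      have h1 := (Finset.card_le_card hsub).trans Finset.card_image_le
      rw [Finset.card_image_of_injective _ (fun i j hij => by simpa [hd] using hij)] at h1
      simp at h1
      omega

theorem rayProg_spec {k n : ℕ} {x : ℕ → ℤ} {σ : RamState} {S : Set ℤ} {u d : ℤ}
    (hE : Env k n x σ) (hx : Set.InjOn x (Finset.range n)) (hS : IsRow n x (σ.arr 4) S)
    (h29 : σ.vars 29 = u) (h30 : σ.vars 30 = d) (hu : u ∈ (Finset.range n).image x) :
    Runs rayProg σ (n * (n * 7 + 2 + 2) + 2) fun τ =>
      IsRow n x (τ.arr 4) (S ∪ ray ((Finset.range n).image x) u d) := by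
  refine (Runs.forLoop (fun s τ => ∃ q, RayInv n x S u d q τ ∧
    (s ≤ q ∨ u + q * d ∉ (Finset.range n).image x)) hE.v1 hE.v2 rfl rfl rfl
    ⟨0, ⟨by simpa using h29, by simp, by simpa using hS⟩, Or.inl le_rfl⟩ ?_).mono le_rfl ?_
  · intro s hs τ hF hi ⟨q₀, hI₀, hdone₀⟩
    have hE' := hE.frame hF rfl
    -- Within a pass, either the ray has advanced or its next element is not among the first `j`.
    refine (Runs.forLoop (fun j τ => ∃ q, RayInv n x S u d q τ ∧
      (s ≤ q ∨ u + q * d ∉ (Finset.range n).image x) ∧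
      (s + 1 ≤ q ∨ ∀ i < j, x i ≠ u + q * d)) hE'.v1 hE'.v2 rfl rfl rfl
      ⟨q₀, by simpa [RayInv] using hI₀, hdone₀, by simp⟩ ?_).mono le_rfl ?_
    · intro j hj υ hF' hi' ⟨q, ⟨hq29, hqX, hrow⟩, hdone, hpass⟩
      refine Runs.of_eval rfl ?_
      have h0 : υ.arr 0 j = x j := by rw [hF'.arr 0 rfl]; exact hE'.input j hj
      have hv2 : υ.vars 2 = 1 := (hF'.vars 2 rfl).trans hE'.v2
      have hv30 : υ.vars 30 = d := (hF'.vars 30 rfl).trans ((hF.vars 30 rfl).trans h30)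
      have hlast : x j ≠ u + q * d → (s + 1 ≤ q ∨ ∀ i < j + 1, x i ≠ u + q * d) := by
        intro hne
        refine hpass.imp_right fun h i hi => ?_
        rcases Nat.lt_succ_iff_lt_or_eq.1 hi with h' | rfl
        · exact h i h'
        · exact hne
      rcases lt_trichotomy (x j) (u + q * d) with h | h | h
      · refine ⟨q, ⟨?_, hqX, ?_⟩, hdone, hlast h.ne⟩ <;> simp [hi', h0, hq29, h, hrow]
      · have hmem : u + q * d ∈ (Finset.range n).image x :=
          h ▸ Finset.mem_image_of_mem x (Finset.mem_range.2 hj)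
        have hsq := hdone.resolve_right fun h => h hmem
        refine ⟨q + 1, ⟨?_, ?_, ?_⟩, Or.inl (by omega), Or.inl (by omega)⟩
        · simp [hi', h0, hq29, h, hv30]
          ring
        · intro i hi
          rcases Nat.lt_succ_iff_lt_or_eq.1 hi with h' | rfl
          · exact hqX i h'
          · exact hmem
        · intro i hi
          have hsplit : x i ∈ S ∪ {y | ∃ i < q + 1, y = u + ((i : ℕ) : ℤ) * d} ↔
              x i ∈ S ∪ {y | ∃ i < q, y = u + ((i : ℕ) : ℤ) * d} ∨ i = j := by
            simp only [Nat.lt_succ_iff_lt_or_eq, or_and_right, exists_or, exists_eq_left,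
              Set.mem_union, Set.mem_ofPred_eq, or_assoc]
            refine or_congr_right (or_congr_right ?_)
            rw [← h]
            exact hx.eq_iff (by simpa using hi) (by simpa using hj)
          rw [hsplit]
          by_cases hij : i = j
          · subst hij
            simp [hi', h0, hq29, h, hv2]
          · have hij' : (i : ℤ) ≠ j := by exact_mod_cast hij
            simpa [hi', h0, hq29, h, hij, hij'] using hrow i hi
      · refine ⟨q, ⟨?_, hqX, ?_⟩, hdone, hlast h.ne'⟩ <;>
          simp [hi', h0, hq29, h, h.not_gt, hrow]
    · rintro υ - ⟨q, hI, -, hpass⟩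
      refine ⟨q, by simpa [RayInv] using hI, hpass.imp_right fun h hmem => ?_⟩
      obtain ⟨i, hi, hxi⟩ := Finset.mem_image.1 hmem
      exact h i (Finset.mem_range.1 hi) hxi
  · rintro τ - ⟨q, ⟨-, hqX, hrow⟩, hdone⟩
    rwa [eq_ray_of_complete hu hqX hdone] at hrow

/-! ### The list of states -/

/-- The row `f` stores the state `p`. -/
def IsState (n : ℕ) (x : ℕ → ℤ) (f : ℤ → ℤ) (p : Finset ℤ × ℕ) : Prop :=
  IsRow n x f p.1 ∧ f n = p.2

theorem IsState.eq_iff {n : ℕ} {x : ℕ → ℤ} {f g : ℤ → ℤ} {p q : Finset ℤ × ℕ}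
    (hf : IsState n x f p) (hg : IsState n x g q) (hp : p.1 ⊆ (Finset.range n).image x)
    (hq : q.1 ⊆ (Finset.range n).image x) : (∀ i < n + 1, f (i : ℕ) = g (i : ℕ)) ↔ p = q := by
  constructor
  · intro h
    refine Prod.ext ?_ ?_
    · have key : ∀ i < n, x i ∈ p.1 ↔ x i ∈ q.1 := by
        intro i hi
        have hfg := h i (by omega)
        by_cases h1 : x i ∈ p.1 <;> by_cases h2 : x i ∈ q.1
        · exact iff_of_true h1 h2
        · rw [(hf.1 i hi).1 h1, (hg.1 i hi).2 h2] at hfg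
          norm_num at hfg
        · rw [(hf.1 i hi).2 h1, (hg.1 i hi).1 h2] at hfg
          norm_num at hfg
        · exact iff_of_false h1 h2
      ext y
      constructor
      · intro hy
        obtain ⟨i, hi, rfl⟩ := Finset.mem_image.1 (hp hy)
        exact (key i (Finset.mem_range.1 hi)).1 hy
      · intro hy
        obtain ⟨i, hi, rfl⟩ := Finset.mem_image.1 (hq hy)
        exact (key i (Finset.mem_range.1 hi)).2 hy
    · have := h n (by omega)
      rw [hf.2, hg.2] at this
      exact_mod_cast this
  · rintro rfl i hi
    rcases Nat.lt_succ_iff_lt_or_eq.1 hi with h | rfl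
    · by_cases h1 : x i ∈ p.1
      · rw [(hf.1 i h).1 h1, (hg.1 i h).1 h1]
      · rw [(hf.1 i h).2 h1, (hg.1 i h).2 h1]
    · rw [hf.2, hg.2]

/-- Array `1` stores the states in `L` one after the other, variable `6` their number, and
variable `9` the first cell behind them. -/
structure Rows (n : ℕ) (x : ℕ → ℤ) (L : List (Finset ℤ × ℕ)) (σ : RamState) : Prop where
  v6 : σ.vars 6 = L.length
  v9 : σ.vars 9 = (L.length * (n + 1) : ℕ)
  row : ∀ r (hr : r < L.length), IsState n x (fun c => σ.arr 1 ((r * (n + 1) : ℕ) + c)) L[r]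

theorem Rows.frame {n : ℕ} {x : ℕ → ℤ} {L : List (Finset ℤ × ℕ)} {p : RamProg} {σ τ : RamState}
    (h : Rows n x L σ) (hF : Frame p σ τ)
    (hp : (p.writesVar 6 || p.writesVar 9 || p.writesArr 1) = false) : Rows n x L τ := by
  simp only [Bool.or_eq_false_iff] at hp
  obtain ⟨⟨h6, h9⟩, hA⟩ := hp
  refine ⟨(hF.vars _ h6).trans h.v6, (hF.vars _ h9).trans h.v9, ?_⟩
  rw [hF.arr _ hA]
  exact h.row

/-- Compare the row in array `1` at the offset in variable `41` with the row in array `4`. -/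
def compareProg : RamProg :=
  seq (const 43 0) (forLoop 44 10 (seq (add 45 41 44) (seq (load 46 1 45) (seq (load 47 4 44)
    (cond 46 47 (const 43 1) (cond 47 46 (const 43 1) skip))))))

theorem compareProg_spec {k n : ℕ} {x : ℕ → ℤ} {σ : RamState} (hE : Env k n x σ) :
    Runs compareProg σ (1 + ((n + 1) * 8 + 2)) fun τ => (τ.vars 43 < 1 ↔
      ∀ i < n + 1, σ.arr 1 (σ.vars 41 + (i : ℕ)) = σ.arr 4 (i : ℕ)) := by
  refine Runs.seq (Runs.of_eval (Q := fun τ => τ.vars 43 = 0) rfl (by simp)) fun τ hF h43 => ?_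
  have hE' := hE.frame hF rfl
  refine Runs.forLoop (fun j τ => (τ.vars 43 < 1 ↔
    ∀ i < j, σ.arr 1 (σ.vars 41 + (i : ℕ)) = σ.arr 4 (i : ℕ))) hE'.v10 hE'.v2 rfl rfl rfl
    (by simp [h43]) ?_
  intro j hj υ hF' hi hI
  refine Runs.of_eval rfl ?_
  have h1 : υ.arr 1 = σ.arr 1 := (hF'.arr 1 rfl).trans (hF.arr 1 rfl)
  have h4 : υ.arr 4 = σ.arr 4 := (hF'.arr 4 rfl).trans (hF.arr 4 rfl)
  have h41 : υ.vars 41 = σ.vars 41 := (hF'.vars 41 rfl).trans (hF.vars 41 rfl)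
  have hsplit : (∀ i < j + 1, σ.arr 1 (σ.vars 41 + (i : ℕ)) = σ.arr 4 (i : ℕ)) ↔
      (∀ i < j, σ.arr 1 (σ.vars 41 + (i : ℕ)) = σ.arr 4 (i : ℕ)) ∧
      σ.arr 1 (σ.vars 41 + (j : ℕ)) = σ.arr 4 (j : ℕ) := by
    simp only [Nat.lt_succ_iff_lt_or_eq, or_imp, forall_and, forall_eq]
  rw [hsplit, ← hI]
  rcases lt_trichotomy (σ.arr 1 (σ.vars 41 + (j : ℕ))) (σ.arr 4 (j : ℕ)) with h | h | h
  · simp [hi, h1, h4, h41, h, h.ne]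
  · simp [hi, h1, h4, h41, h]
  · simp [hi, h1, h4, h41, h, h.ne', h.not_gt]

/-- Search array `1` for the row in array `4`. -/
def findProg : RamProg :=
  seq (seq (const 40 0) (const 41 0)) (forLoop 42 6 (seq compareProg
    (seq (cond 43 2 (const 40 1) skip) (add 41 41 10))))

theorem findProg_spec {k n N : ℕ} {x : ℕ → ℤ} {σ : RamState} (hE : Env k n x σ)
    (h6 : σ.vars 6 = N) :
    Runs findProg σ (2 + (N * (1 + ((n + 1) * 8 + 2) + 3 + 2) + 2)) fun τ => (τ.vars 40 < 1 ↔
      ∀ r < N, ¬ ∀ i < n + 1, σ.arr 1 ((r * (n + 1) : ℕ) + (i : ℕ)) = σ.arr 4 (i : ℕ)) := by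
  refine Runs.seq (Runs.of_eval (Q := fun τ => τ.vars 40 = 0 ∧ τ.vars 41 = 0) rfl (by simp))
    fun τ hF ⟨h40, h41⟩ => ?_
  have hE' := hE.frame hF rfl
  refine (Runs.forLoop (fun j τ => (τ.vars 40 < 1 ↔
    ∀ r < j, ¬ ∀ i < n + 1, σ.arr 1 ((r * (n + 1) : ℕ) + (i : ℕ)) = σ.arr 4 (i : ℕ)) ∧
    τ.vars 41 = (j * (n + 1) : ℕ)) ((hF.vars 6 rfl).trans h6) hE'.v2 rfl rfl rfl
    (by simp [h40, h41]) ?_).mono le_rfl (fun _ _ h => h.1)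
  intro j hj υ hF' hi ⟨hI, hI41⟩
  have hE'' := hE'.frame hF' rfl
  refine Runs.seq (compareProg_spec hE'') fun ρ hF'' h43 => ?_
  have hE''' := hE''.frame hF'' rfl
  rw [hF'.arr 1 rfl, hF.arr 1 rfl, hF'.arr 4 rfl, hF.arr 4 rfl, hI41] at h43
  rw [← hF''.vars 40 rfl] at hI
  have h41' : ρ.vars 41 = (j * (n + 1) : ℕ) := (hF''.vars 41 rfl).trans hI41
  refine Runs.of_eval rfl ?_
  have hsplit : (∀ r < j + 1, ¬ ∀ i < n + 1,
        σ.arr 1 ((r * (n + 1) : ℕ) + (i : ℕ)) = σ.arr 4 (i : ℕ)) ↔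
      ρ.vars 40 < 1 ∧ ¬ ρ.vars 43 < 1 := by
    rw [hI, h43]
    simp only [Nat.lt_succ_iff_lt_or_eq, or_imp, forall_and, forall_eq]
  refine ⟨?_, ?_⟩
  · rw [hsplit]
    by_cases h : ρ.vars 43 < 1
    · simp [hE'''.v2, h]
    · simp [hE'''.v2, h]
  · by_cases h : ρ.vars 43 < 1
    · simp [hE'''.v2, h, h41', hE'''.v10]
      ring
    · simp [hE'''.v2, h, h41', hE'''.v10]
      ring

/-- Append a state unless it is listed already. -/
def addState (L : List (Finset ℤ × ℕ)) (p : Finset ℤ × ℕ) : List (Finset ℤ × ℕ) :=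
  if p ∈ L then L else L ++ [p]

/-- Append the row in array `4` to the list in array `1` unless it is there already. -/
def insertProg : RamProg :=
  seq findProg (cond 40 2 (seq (copyProg 4 3 1 9) (seq (add 6 6 2) (add 9 9 10))) skip)

/-- A bound for the number of steps of `insertProg` when there are at most `M` states. -/
def insertTime (n M : ℕ) : ℕ :=
  2 + (M * (1 + ((n + 1) * 8 + 2) + 3 + 2) + 2) + ((n + 1) * 6 + 2 + 2 + 1)

theorem insertProg_spec {k n M : ℕ} {x : ℕ → ℤ} {σ : RamState} {L : List (Finset ℤ × ℕ)}
    {p : Finset ℤ × ℕ} (hE : Env k n x σ) (hR : Rows n x L σ) (hM : L.length ≤ M)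
    (hL : ∀ q ∈ L, q.1 ⊆ (Finset.range n).image x) (hp : p.1 ⊆ (Finset.range n).image x)
    (h4 : IsState n x (σ.arr 4) p) :
    Runs insertProg σ (insertTime n M) fun τ => Rows n x (addState L p) τ := by
  refine (Runs.seq (findProg_spec hE hR.v6) fun τ hF h40 => ?_).mono
    (T := _ + ((n + 1) * 6 + 2 + 2 + 1))
    (by unfold insertTime; gcongr) fun _ _ h => h
  have hE' := hE.frame hF rfl
  have hR' := hR.frame hF rfl
  have hnot : τ.vars 40 < 1 ↔ p ∉ L := by
    rw [h40]
    constructor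
    · intro h hpL
      obtain ⟨r, hr, rfl⟩ := List.getElem_of_mem hpL
      exact h r hr (((hR.row r hr).eq_iff h4 (hL _ hpL) hp).2 rfl)
    · intro h r hr heq
      have := ((hR.row r hr).eq_iff h4 (hL _ (List.getElem_mem hr)) hp).1 heq
      exact h (this ▸ List.getElem_mem hr)
  rw [← hE'.v2] at hnot
  refine Runs.cond (fun h => ?_) fun h => ?_
  · rw [addState, if_neg (hnot.1 h)]
    refine Runs.seq (T := (n + 1) * 6 + 2) (T' := 2) (copyProg_spec (A := 4) (B := 1) (b := 9)
      hE'.v10 hE'.v2 hE'.v3 hR'.v9 (by norm_num) rfl rfl) fun υ hF' h1 => ?_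
    refine Runs.of_eval (p := seq _ _) rfl ?_
    have hE'' := hE'.frame hF' rfl
    have h6 : υ.vars 6 = L.length := (hF'.vars 6 rfl).trans hR'.v6
    have h9 : υ.vars 9 = (L.length * (n + 1) : ℕ) := (hF'.vars 9 rfl).trans hR'.v9
    refine ⟨?_, ?_, fun r hr => ?_⟩
    · simp [h6, hE''.v2]
    · simp [h9, hE''.v10]
      ring
    · simp only [eval, RamState.setVar_arr]
      rw [List.length_append, List.length_singleton] at hr
      rcases Nat.lt_succ_iff_lt_or_eq.1 hr with hlt | rfl
      · rw [List.getElem_append_left hlt]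
        have hrow := hR'.row r hlt
        have hle : (r + 1) * (n + 1) ≤ L.length * (n + 1) := Nat.mul_le_mul_right _ hlt
        have hcell : ∀ i < n + 1, υ.arr 1 ((r * (n + 1) : ℕ) + (i : ℕ)) =
            τ.arr 1 ((r * (n + 1) : ℕ) + (i : ℕ)) := by
          intro i hi
          rw [h1, if_neg]
          rw [add_mul, one_mul] at hle
          omega
        exact ⟨fun i hi => by simpa only [hcell i (by omega)] using hrow.1 i hi,
          (hcell n (by omega)).trans hrow.2⟩
      · rw [List.getElem_concat_length rfl]
        have hcell : ∀ i < n + 1, υ.arr 1 ((L.length * (n + 1) : ℕ) + (i : ℕ)) =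
            σ.arr 4 (i : ℕ) := by
          intro i hi
          rw [h1, if_pos (by omega), hF.arr 4 rfl]
          congr 1
          ring
        exact ⟨fun i hi => by simpa only [hcell i (by omega)] using h4.1 i hi,
          (hcell n (by omega)).trans h4.2⟩
  · rw [addState, if_pos (not_not.1 fun h' => h (hnot.2 h'))]
    exact (Runs.of_eval (p := skip) (Q := Rows n x L) rfl hR').mono
      (by simp only [cost]; omega) fun _ _ h => h

/-! ### Expanding a state -/

/-- Add to the list the child of the state in array `3` given by the element `u` in variable `35`
and the difference in variable `30`. -/
def expandProg : RamProg :=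
  seq (copyProg 3 3 4 3) (seq (add 29 35 3) (seq rayProg (seq (seq (add 29 35 3) (sub 30 3 30))
    (seq rayProg (seq (seq (add 48 24 2) (store 4 1 48)) insertProg)))))

/-- A bound for the number of steps of `expandProg` when there are at most `M` states. -/
def expandTime (n M : ℕ) : ℕ :=
  (n + 1) * 6 + 2 + (1 + (n * (n * 7 + 2 + 2) + 2 + (2 + (n * (n * 7 + 2 + 2) + 2 +
    (2 + insertTime n M)))))

theorem expandProg_spec {k n M : ℕ} {x : ℕ → ℤ} {σ : RamState} {L : List (Finset ℤ × ℕ)}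
    {S : Finset ℤ} {j : ℕ} {u y : ℤ} (hx : Set.InjOn x (Finset.range n))
    (hE : Env k n x σ) (hR : Rows n x L σ) (hM : L.length ≤ M)
    (hL : ∀ q ∈ L, q.1 ⊆ (Finset.range n).image x) (hS : S ⊆ (Finset.range n).image x)
    (h3 : IsRow n x (σ.arr 3) S) (h24 : σ.vars 24 = j) (h35 : σ.vars 35 = u)
    (h30 : σ.vars 30 = y - u) (hu : u ∈ (Finset.range n).image x) :
    Runs expandProg σ (expandTime n M) fun τ =>
      Rows n x (addState L (child ((Finset.range n).image x) S u y, j + 1)) τ := by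
  refine Runs.seq (copyProg_spec hE.v10 hE.v2 hE.v3 hE.v3 (by norm_num) rfl rfl) fun τ hF h4 => ?_
  have hE1 := hE.frame hF rfl
  have hrow1 : IsRow n x (τ.arr 4) S := by
    intro i hi
    rw [h4, if_pos (by omega)]
    simpa using h3 i hi
  refine Runs.seq (Runs.of_eval (Q := fun υ => υ.vars 29 = u) rfl (by
    simp [hE1.v3, hF.vars 35 rfl, h35])) fun τ2 hF2 h29 => ?_
  have hE2 := hE1.frame hF2 rfl
  refine Runs.seq (rayProg_spec (S := S) hE2 hx (by rw [hF2.arr 4 rfl]; exact hrow1) h29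
    (by rw [hF2.vars 30 rfl, hF.vars 30 rfl, h30]) hu) fun τ3 hF3 hrow3 => ?_
  have hE3 := hE2.frame hF3 rfl
  refine Runs.seq (Runs.of_eval (p := seq _ _) (Q := fun υ => υ.vars 29 = u ∧ υ.vars 30 = -(y - u))
    rfl (by
      simp [hE3.v3, hF3.vars 35 rfl, hF2.vars 35 rfl, hF.vars 35 rfl, h35, hF3.vars 30 rfl,
        hF2.vars 30 rfl, hF.vars 30 rfl, h30])) fun τ4 hF4 ⟨h29, h30'⟩ => ?_
  have hE4 := hE3.frame hF4 rfl
  refine Runs.seq (rayProg_spec hE4 hx (by rw [hF4.arr 4 rfl]; exact hrow3) h29 h30' hu)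
    fun τ5 hF5 hrow5 => ?_
  have hE5 := hE4.frame hF5 rfl
  have h24' : τ5.vars 24 = j := by
    rw [hF5.vars 24 rfl, hF4.vars 24 rfl, hF3.vars 24 rfl, hF2.vars 24 rfl, hF.vars 24 rfl, h24]
  refine Runs.seq (Runs.of_eval (p := seq _ _) (Q := fun υ => IsState n x (υ.arr 4)
    (child ((Finset.range n).image x) S u y, j + 1)) rfl ?_) fun τ6 hF6 h6 => ?_
  · refine ⟨fun i hi => ?_, by simp [hE5.v1, hE5.v2, h24']⟩
    have hne : (i : ℤ) ≠ n := by omega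
    have := hrow5 i hi
    rw [Set.union_assoc, ← Finset.coe_union, ← Finset.coe_union] at this
    simpa [hE5.v1, hne, child, line] using this
  · have hE6 := hE5.frame hF6 rfl
    refine insertProg_spec hE6 ?_ hM hL ?_ h6
    · exact (((((hR.frame hF rfl).frame hF2 rfl).frame hF3 rfl).frame hF4 rfl).frame hF5 rfl).frame
        hF6 rfl
    · exact Finset.union_subset hS (line_subset _ _ _)

/-- Expand the state in array `3` by the pair with indices in variables `25` and `26`, if it is
allowed. -/
def tryProg : RamProg := seq allowedProg (cond 3 27 expandProg skip)

/-- A bound for the number of steps of `tryProg` when there are at most `M` states. -/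
def tryTime (k n M : ℕ) : ℕ :=
  8 + (2 ^ k * (1 + (n * 9 + 2) + 2) + 2) + (expandTime n M + 1)

open Classical in
theorem tryProg_spec {k n M : ℕ} {x : ℕ → ℤ} {σ : RamState} {L : List (Finset ℤ × ℕ)}
    {S : Finset ℤ} {j a b : ℕ} (hx : Set.InjOn x (Finset.range n))
    (hE : Env k n x σ) (hR : Rows n x L σ) (hM : L.length ≤ M)
    (hL : ∀ q ∈ L, q.1 ⊆ (Finset.range n).image x) (hS : S ⊆ (Finset.range n).image x)
    (h3 : IsRow n x (σ.arr 3) S) (h24 : σ.vars 24 = j)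
    (ha : a < n) (hb : b < n) (h25 : σ.vars 25 = a) (h26 : σ.vars 26 = b)
    (h16 : σ.vars 16 = (((Finset.range n).image x \ S).card : ℕ))
    (h2 : IsRow n x (σ.arr 2) (firstUncovered k ((Finset.range n).image x) S)) :
    Runs tryProg σ (tryTime k n M) fun τ =>
      Rows n x (if Allowed k ((Finset.range n).image x) S (x a) (x b) then
        addState L (child ((Finset.range n).image x) S (x a) (x b), j + 1) else L) τ := by
  refine Runs.seq (allowedProg_spec hE ha hb h25 h26 h16 h2) fun τ hF ⟨h27, h35, h30⟩ => ?_
  have hE' := hE.frame hF rfl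
  have hR' := hR.frame hF rfl
  refine Runs.cond (fun h => ?_) fun h => ?_
  · rw [hE'.v3, h27] at h
    rw [if_pos h]
    exact expandProg_spec hx hE' hR' hM hL hS (by rw [hF.arr 3 rfl]; exact h3)
      ((hF.vars 24 rfl).trans h24) h35 h30 (Finset.mem_image_of_mem x (Finset.mem_range.2 ha))
  · rw [hE'.v3, h27] at h
    rw [if_neg h]
    exact (Runs.of_eval (p := skip) (Q := Rows n x L) rfl hR').mono
      (by simp only [cost, expandTime]; omega) fun _ _ h => h

/-! ### The search -/

/-- A duplicate-free list of reachable states. -/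
def IsStateList (k : ℕ) (X : Finset ℤ) (L : List (Finset ℤ × ℕ)) : Prop :=
  L.Nodup ∧ ∀ p ∈ L, Reach k X p.1 p.2

theorem mem_addState (L : List (Finset ℤ × ℕ)) (p : Finset ℤ × ℕ) : p ∈ addState L p := by
  unfold addState
  split_ifs with h
  · exact h
  · simp

theorem prefix_addState (L : List (Finset ℤ × ℕ)) (p : Finset ℤ × ℕ) : L <+: addState L p := by
  unfold addState
  split_ifs with h
  · exact List.prefix_rfl
  · exact List.prefix_append _ _

theorem IsStateList.addState {k : ℕ} {X : Finset ℤ} {L : List (Finset ℤ × ℕ)}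
    (h : IsStateList k X L) {p : Finset ℤ × ℕ} (hp : Reach k X p.1 p.2) :
    IsStateList k X (addState L p) := by
  unfold _root_.addState
  split_ifs with hm
  · exact h
  · refine ⟨List.nodup_append.2 ⟨h.1, List.nodup_singleton _, ?_⟩, ?_⟩
    · rintro a ha b hb rfl
      exact hm (List.mem_singleton.1 hb ▸ ha)
    · intro q hq
      rcases List.mem_append.1 hq with hq | hq
      · exact h.2 q hq
      · rw [List.mem_singleton.1 hq]
        exact hp

/-- Try all pairs for the state in array `3`. -/
def pairsProg : RamProg := forLoop 25 1 (forLoop 26 1 tryProg)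

/-- A bound for the number of steps of `pairsProg` when there are at most `M` states. -/
def pairsTime (k n M : ℕ) : ℕ := n * (n * (tryTime k n M + 2) + 2 + 2) + 2

theorem pairsProg_spec {k n M : ℕ} {x : ℕ → ℤ} {σ : RamState} {L : List (Finset ℤ × ℕ)}
    {S : Finset ℤ} {j : ℕ} (hx : Set.InjOn x (Finset.range n))
    (hM : ∀ L, IsStateList k ((Finset.range n).image x) L → L.length ≤ M)
    (hE : Env k n x σ) (hR : Rows n x L σ) (hL : IsStateList k ((Finset.range n).image x) L)
    (hS : Reach k ((Finset.range n).image x) S j) (hj : j < k)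
    (h3 : IsRow n x (σ.arr 3) S) (h24 : σ.vars 24 = j)
    (h16 : σ.vars 16 = (((Finset.range n).image x \ S).card : ℕ))
    (h2 : IsRow n x (σ.arr 2) (firstUncovered k ((Finset.range n).image x) S)) :
    Runs pairsProg σ (pairsTime k n M) fun τ =>
      ∃ L', L <+: L' ∧ IsStateList k ((Finset.range n).image x) L' ∧ Rows n x L' τ ∧
        ∀ a < n, ∀ b < n, Allowed k ((Finset.range n).image x) S (x a) (x b) →
          (child ((Finset.range n).image x) S (x a) (x b), j + 1) ∈ L' := by
  classical
  set X := (Finset.range n).image x with hX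
  have hmem : ∀ a < n, x a ∈ X := fun a ha => Finset.mem_image_of_mem x (Finset.mem_range.2 ha)
  refine Runs.forLoop (fun a τ => ∃ L', L <+: L' ∧ IsStateList k X L' ∧ Rows n x L' τ ∧
    ∀ a' < a, ∀ b < n, Allowed k X S (x a') (x b) → (child X S (x a') (x b), j + 1) ∈ L')
    hE.v1 hE.v2 rfl rfl rfl
    ⟨L, List.prefix_rfl, hL, hR.frame (Exec.const σ 25 0).frame rfl, by simp⟩ ?_
  intro a ha τ hF h25 ⟨L₁, hpre₁, hL₁, hR₁, hch₁⟩
  have hE1 := hE.frame hF rfl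
  refine (Runs.forLoop (fun b τ => ∃ L', L₁ <+: L' ∧ IsStateList k X L' ∧ Rows n x L' τ ∧
    ∀ b' < b, Allowed k X S (x a) (x b') → (child X S (x a) (x b'), j + 1) ∈ L')
    hE1.v1 hE1.v2 rfl rfl rfl
    ⟨L₁, List.prefix_rfl, hL₁, hR₁.frame (Exec.const τ 26 0).frame rfl, by simp⟩ ?_).mono le_rfl ?_
  · intro b hb υ hF' h26 ⟨L₂, hpre₂, hL₂, hR₂, hch₂⟩
    refine (tryProg_spec (S := S) (j := j) hx (hE1.frame hF' rfl) hR₂ (hM _ hL₂)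
      (fun q hq => (hL₂.2 q hq).subset) hS.subset ?_ ?_ ha hb ((hF'.vars 25 rfl).trans h25) h26
      ?_ ?_).mono le_rfl ?_
    · rw [hF'.arr 3 rfl, hF.arr 3 rfl]; exact h3
    · rw [hF'.vars 24 rfl, hF.vars 24 rfl, h24]
    · rw [hF'.vars 16 rfl, hF.vars 16 rfl, h16]
    · rw [hF'.arr 2 rfl, hF.arr 2 rfl]; exact h2
    · intro ρ _ hρ
      rw [← hX] at hρ
      refine ⟨_, ?_, ?_, hρ.frame (Exec.const ρ 26 _).frame rfl, ?_⟩
      · split_ifs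
        · exact hpre₂.trans (prefix_addState _ _)
        · exact hpre₂
      · split_ifs with hal
        · exact hL₂.addState (hS.step hj (hmem a ha) (hmem b hb) hal)
        · exact hL₂
      · intro b' hb' hal
        rcases Nat.lt_succ_iff_lt_or_eq.1 hb' with hlt | rfl
        · have := hch₂ b' hlt hal
          split_ifs
          · exact (prefix_addState _ _).subset this
          · exact this
        · rw [if_pos hal]
          exact mem_addState _ _
  · rintro υ - ⟨L₂, hpre₂, hL₂, hR₂, hch₂⟩
    refine ⟨L₂, hpre₁.trans hpre₂, hL₂, hR₂.frame (Exec.const υ 25 _).frame rfl, ?_⟩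
    intro a' ha' b hb hal
    rcases Nat.lt_succ_iff_lt_or_eq.1 ha' with hlt | rfl
    · exact hpre₂.subset (hch₁ a' hlt b hb hal)
    · exact hch₂ b hb hal

/-- Process the state at the offset in variable `8`. -/
def visitProg : RamProg :=
  seq (copyProg 1 8 3 3) (seq countProg (seq (cond 16 2 (const 11 1) skip) (seq markProg
    (seq (load 24 3 1) (seq (cond 24 0 pairsProg skip) (seq (add 7 7 2) (add 8 8 10)))))))

/-- A bound for the number of steps of `visitProg` when there are at most `M` states. -/
def visitTime (k n M : ℕ) : ℕ :=
  (n + 1) * 6 + 2 + (1 + (n * 5 + 2) + (2 + (n * (1 + (1 + (n * 7 + 2)) + 6 + 2) + 2 +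
    (1 + (pairsTime k n M + 1 + 2)))))

/-- The invariant of the search: the first `h` states of the list `L` have been processed. -/
structure SearchInv (k n : ℕ) (x : ℕ → ℤ) (L : List (Finset ℤ × ℕ)) (h : ℕ) (σ : RamState) :
    Prop where
  env : Env k n x σ
  rows : Rows n x L σ
  list : IsStateList k ((Finset.range n).image x) L
  init : (∅, 0) ∈ L
  le : h ≤ L.length
  v7 : σ.vars 7 = h
  v8 : σ.vars 8 = (h * (n + 1) : ℕ)
  closed : ∀ p ∈ L.take h, p.2 < k → ∀ a < n, ∀ b < n,
    Allowed k ((Finset.range n).image x) p.1 (x a) (x b) →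
      (child ((Finset.range n).image x) p.1 (x a) (x b), p.2 + 1) ∈ L
  yes : (∃ p ∈ L.take h, (Finset.range n).image x \ p.1 = ∅) → σ.vars 11 = 1
  no : (¬ ∃ p ∈ L.take h, (Finset.range n).image x \ p.1 = ∅) → σ.vars 11 = 0

theorem visitProg_spec {k n M : ℕ} {x : ℕ → ℤ} {σ : RamState} {L : List (Finset ℤ × ℕ)} {h : ℕ}
    (hx : Set.InjOn x (Finset.range n))
    (hM : ∀ L, IsStateList k ((Finset.range n).image x) L → L.length ≤ M)
    (hI : SearchInv k n x L h σ) (hlt : h < L.length) :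
    Runs visitProg σ (visitTime k n M) fun τ => ∃ L', SearchInv k n x L' (h + 1) τ := by
  rcases hp : L[h] with ⟨S, j⟩
  have hE := hI.env
  have hpL : (S, j) ∈ L := hp ▸ List.getElem_mem hlt
  have hS : Reach k ((Finset.range n).image x) S j := hI.list.2 _ hpL
  refine Runs.seq (copyProg_spec (A := 1) (B := 3) hE.v10 hE.v2 hI.v8 hE.v3 (by norm_num) rfl rfl)
    fun τ1 hF1 h1 => ?_
  have hE1 := hE.frame hF1 rfl
  have hst : IsState n x (τ1.arr 3) (S, j) := by
    have hrow := hI.rows.row h hlt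
    rw [hp] at hrow
    have hcell : ∀ i < n + 1, τ1.arr 3 (i : ℕ) = σ.arr 1 ((h * (n + 1) : ℕ) + (i : ℕ)) := by
      intro i hi
      rw [h1, if_pos (by omega), sub_zero]
    exact ⟨fun i hi => by simpa only [hcell i (by omega)] using hrow.1 i hi,
      (hcell n (by omega)).trans hrow.2⟩
  refine Runs.seq (countProg_spec hx hE1 hst.1) fun τ2 hF2 h16 => ?_
  have hE2 := hE1.frame hF2 rfl
  have h11 : τ2.vars 11 = σ.vars 11 := (hF2.vars 11 rfl).trans (hF1.vars 11 rfl)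
  refine Runs.seq (Runs.of_eval (Q := fun τ => τ.vars 11 =
    if (Finset.range n).image x \ S = ∅ then 1 else σ.vars 11) rfl ?_) fun τ3 hF3 h11' => ?_
  · by_cases hE0 : (Finset.range n).image x \ S = ∅
    · rw [hE0] at h16
      simp [hE0, h16, hE2.v2]
    · have : ¬ (((Finset.range n).image x \ S).card : ℤ) < 1 := by
        have := Finset.card_pos.2 (Finset.nonempty_iff_ne_empty.2 hE0)
        omega
      simp only [eval, h16, hE2.v2, this, if_false, h11, hE0]
  have hE3 := hE2.frame hF3 rfl
  have h3 : τ3.arr 3 = τ1.arr 3 := (hF3.arr 3 rfl).trans (hF2.arr 3 rfl)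
  refine Runs.seq (markProg_spec (S := S) hx hE3 (by rw [h3]; exact hst.1)) fun τ4 hF4 h2 => ?_
  have hE4 := hE3.frame hF4 rfl
  have h3' : τ4.arr 3 = τ1.arr 3 := (hF4.arr 3 rfl).trans h3
  refine Runs.seq (Runs.of_eval (Q := fun τ => τ.vars 24 = j) rfl ?_) fun τ5 hF5 h24 => ?_
  · simpa [hE4.v1, h3'] using hst.2
  have hE5 := hE4.frame hF5 rfl
  have hR5 : Rows n x L τ5 := ((((hI.rows.frame hF1 rfl).frame hF2 rfl).frame hF3 rfl).frame hF4
    rfl).frame hF5 rfl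
  refine Runs.seq (Q := fun τ => ∃ L', L <+: L' ∧ IsStateList k ((Finset.range n).image x) L' ∧
      Rows n x L' τ ∧ (j < k → ∀ a < n, ∀ b < n,
        Allowed k ((Finset.range n).image x) S (x a) (x b) →
          (child ((Finset.range n).image x) S (x a) (x b), j + 1) ∈ L'))
    (Runs.cond (fun hlt' => ?_) fun hlt' => ?_) fun τ6 hF6 ⟨L', hpre, hL', hR', hch⟩ => ?_
  · rw [h24, hE5.v0, Nat.cast_lt] at hlt'
    refine (pairsProg_spec (S := S) (j := j) hx hM hE5 hR5 hI.list hS hlt' ?_ h24 ?_ ?_).mono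
      le_rfl ?_
    · rw [hF5.arr 3 rfl, h3']; exact hst.1
    · rw [hF5.vars 16 rfl, hF4.vars 16 rfl, hF3.vars 16 rfl, h16]
    · rw [hF5.arr 2 rfl]; exact h2
    · rintro τ - ⟨L', h1, h2, h3, h4⟩
      exact ⟨L', h1, h2, h3, fun _ => h4⟩
  · rw [h24, hE5.v0, Nat.cast_lt] at hlt'
    exact (Runs.of_eval (p := skip) (Q := fun τ => τ = τ5) rfl rfl).mono
      (by simp only [cost, pairsTime]; omega)
      fun τ _ hτ => ⟨L, List.prefix_rfl, hI.list, hτ ▸ hR5, fun h => absurd h hlt'⟩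
  · have hE6 := hE5.frame hF6 rfl
    have h7 : τ6.vars 7 = h := by
      rw [hF6.vars 7 rfl, hF5.vars 7 rfl, hF4.vars 7 rfl, hF3.vars 7 rfl, hF2.vars 7 rfl,
        hF1.vars 7 rfl, hI.v7]
    have h8 : τ6.vars 8 = (h * (n + 1) : ℕ) := by
      rw [hF6.vars 8 rfl, hF5.vars 8 rfl, hF4.vars 8 rfl, hF3.vars 8 rfl, hF2.vars 8 rfl,
        hF1.vars 8 rfl, hI.v8]
    have h11'' : τ6.vars 11 = if (Finset.range n).image x \ S = ∅ then 1 else σ.vars 11 := by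
      rw [hF6.vars 11 rfl, hF5.vars 11 rfl, hF4.vars 11 rfl, h11']
    have htake : L'.take (h + 1) = L.take h ++ [(S, j)] := by
      have hlt' : h < L'.length := hlt.trans_le hpre.length_le
      rw [List.take_succ_eq_append_getElem hlt', hpre.getElem hlt |>.symm, hp]
      congr 1
      obtain ⟨t, rfl⟩ := hpre
      rw [List.take_append_of_le_length hlt.le]
    refine (Runs.of_eval (p := seq (add 7 7 2) (add 8 8 10)) (Q := fun τ => τ =
      (seq (add 7 7 2) (add 8 8 10)).eval τ6) rfl rfl).mono le_rfl fun τ hF7 hτ => ⟨L', ?_⟩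
    have hvars11 : τ.vars 11 = τ6.vars 11 := hF7.vars 11 rfl
    have hex : (∃ p ∈ L'.take (h + 1), (Finset.range n).image x \ p.1 = ∅) ↔
        (∃ p ∈ L.take h, (Finset.range n).image x \ p.1 = ∅) ∨
          (Finset.range n).image x \ S = ∅ := by
      rw [htake]
      simp only [List.mem_append, List.mem_singleton, or_and_right, exists_or, exists_eq_left]
    refine ⟨hE6.frame hF7 rfl, hR'.frame hF7 rfl, hL', hpre.subset hI.init,
      Nat.succ_le_of_lt (hlt.trans_le hpre.length_le), ?_, ?_, ?_, ?_, ?_⟩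
    · simp [hτ, h7, hE6.v2]
    · simp [hτ, h8, hE6.v10]
      ring
    · intro p hp' hpk a ha b hb hal
      rw [htake] at hp'
      rcases List.mem_append.1 hp' with hp' | hp'
      · exact hpre.subset (hI.closed p hp' hpk a ha b hb hal)
      · obtain rfl := List.mem_singleton.1 hp'
        exact hch hpk a ha b hb hal
    · intro hyes
      rw [hvars11, h11'']
      split_ifs with h0
      · rfl
      · exact hI.yes ((hex.1 hyes).resolve_right h0)
    · intro hno
      rw [hex, not_or] at hno
      rw [hvars11, h11'', if_neg hno.2]
      exact hI.no hno.1

/-- Process the states in the order of the list until none is left. -/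
def searchProg : RamProg := loop 7 6 visitProg

theorem searchProg_spec {k n M : ℕ} {x : ℕ → ℤ} {σ : RamState}
    (hx : Set.InjOn x (Finset.range n))
    (hM : ∀ L, IsStateList k ((Finset.range n).image x) L → L.length ≤ M)
    (hI : SearchInv k n x [(∅, 0)] 0 σ) :
    Runs searchProg σ (M * (visitTime k n M + 1) + 1) fun τ => Env k n x τ ∧
      ((∃ S j, Reach k ((Finset.range n).image x) S j ∧ (Finset.range n).image x \ S = ∅) →
        τ.vars 11 = 1) ∧
      ((¬ ∃ S j, Reach k ((Finset.range n).image x) S j ∧ (Finset.range n).image x \ S = ∅) →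
        τ.vars 11 = 0) := by
  refine (Runs.loop (fun m τ => ∃ L h, m + h = M ∧ SearchInv k n x L h τ) ?_ M σ
    ⟨_, 0, rfl, hI⟩).mono le_rfl ?_
  · rintro m τ ⟨L, h, hm, hI⟩ hlt
    rw [hI.v7, hI.rows.v6, Nat.cast_lt] at hlt
    have hLM := hM L hI.list
    refine (visitProg_spec hx hM hI hlt).mono le_rfl ?_
    rintro υ - ⟨L', hI'⟩
    exact ⟨m - 1, by omega, L', h + 1, by omega, hI'⟩
  · rintro τ - ⟨⟨m, L, h, -, hI⟩, hge⟩
    rw [hI.v7, hI.rows.v6, Nat.cast_lt, not_lt] at hge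
    have htake : L.take h = L := List.take_of_length_le hge
    have hall : ∀ S j, Reach k ((Finset.range n).image x) S j → (S, j) ∈ L := by
      intro S j hS
      induction hS with
      | init => exact hI.init
      | step _ hj hu hy hal ih =>
        obtain ⟨a, ha, rfl⟩ := Finset.mem_image.1 hu
        obtain ⟨b, hb, rfl⟩ := Finset.mem_image.1 hy
        exact hI.closed _ (by rw [htake]; exact ih) hj a (Finset.mem_range.1 ha) b
          (Finset.mem_range.1 hb) hal
    have hiff : (∃ S j, Reach k ((Finset.range n).image x) S j ∧
        (Finset.range n).image x \ S = ∅) ↔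
        ∃ p ∈ L.take h, (Finset.range n).image x \ p.1 = ∅ := by
      rw [htake]
      exact ⟨fun ⟨S, j, h1, h2⟩ => ⟨_, hall S j h1, h2⟩, fun ⟨p, h1, h2⟩ =>
        ⟨_, _, hI.list.2 p h1, h2⟩⟩
    rw [hiff]
    exact ⟨hI.env, hI.yes, hI.no⟩

/-! ### The complete program -/

/-- Set up the constants and the list consisting of the state `(∅, 0)`, whose row is all zeros. -/
def initProg : RamProg :=
  seq (seq (const 2 1) (seq (const 4 1) (const 5 1))) (seq (forLoop 49 0 (add 4 4 0))
    (seq (forLoop 49 0 (add 5 5 5)) (seq (add 10 1 2) (seq (const 6 1) (add 9 10 3)))))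

theorem initProg_spec (k : ℕ) (xs : List ℤ) :
    Runs initProg (capInput k xs) (3 + (k * 3 + 2 + (k * 3 + 2 + 3)))
      (SearchInv k xs.length (fun i => xs.getD i 0) [(∅, 0)] 0) := by
  refine Runs.seq (Runs.of_eval (Q := fun τ => τ.vars 2 = 1 ∧ τ.vars 4 = 1 ∧ τ.vars 5 = 1) rfl
    (by simp)) fun τ1 hF1 ⟨h2, h4, h5⟩ => ?_
  have h0 : τ1.vars 0 = k := hF1.vars 0 rfl
  refine Runs.seq (Runs.forLoop (fun j τ => τ.vars 4 = (j * k + 1 : ℕ)) h0 h2 rfl rfl rfl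
    (by simp [h4]) ?_) fun τ2 hF2 h4' => ?_
  · intro j _ τ hF _ hI
    refine Runs.of_eval (p := add 4 4 0) rfl ?_
    simp [hI, hF.vars 0 rfl, h0]
    ring
  refine Runs.seq (Runs.forLoop (fun j τ => τ.vars 5 = (2 ^ j : ℕ)) ((hF2.vars 0 rfl).trans h0)
    ((hF2.vars 2 rfl).trans h2) rfl rfl rfl (by simp [hF2.vars 5 rfl, h5]) ?_) fun τ3 hF3 h5' => ?_
  · intro j _ τ hF _ hI
    refine Runs.of_eval (p := add 5 5 5) rfl ?_
    simp [hI]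
    ring
  have hv : ∀ y, y ≠ 2 → y ≠ 4 → y ≠ 5 → y ≠ 49 → τ3.vars y = (capInput k xs).vars y := by
    intro y h2 h4 h5 h49
    rw [hF3.vars y, hF2.vars y, hF1.vars y] <;>
      simp [RamProg.forLoop, writesVar, h2.symm, h4.symm, h5.symm, h49.symm]
  have hA : τ3.arr = (capInput k xs).arr := by
    funext A
    rw [hF3.arr A rfl, hF2.arr A rfl, hF1.arr A rfl]
  refine (Runs.of_eval (p := seq (add 10 1 2) (seq (const 6 1) (add 9 10 3))) (Q := fun τ => τ =
      (seq (add 10 1 2) (seq (const 6 1) (add 9 10 3))).eval τ3) rfl rfl).mono le_rfl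
    fun τ hF hτ => ?_
  have h3 : τ3.vars 3 = 0 := by rw [hv 3] <;> simp [capInput]
  have h1 : τ3.vars 1 = xs.length := by rw [hv 1] <;> simp [capInput]
  have h2' : τ3.vars 2 = 1 := by rw [hF3.vars 2 rfl, hF2.vars 2 rfl, h2]
  have h4'' : τ3.vars 4 = (k ^ 2 + 1 : ℕ) := by rw [hF3.vars 4 rfl, h4', pow_two]
  refine ⟨⟨?_, ?_, ?_, ?_, ?_, ?_, ?_, ?_⟩, ⟨?_, ?_, ?_⟩, ⟨?_, ?_⟩, ?_, ?_, ?_, ?_, ?_, ?_, ?_⟩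
  · rw [hF.vars 0 rfl, hv 0] <;> simp [capInput]
  · rw [hF.vars 1 rfl, h1]
  · rw [hF.vars 2 rfl, h2']
  · rw [hF.vars 3 rfl, h3]
  · rw [hF.vars 4 rfl, h4'']
  · rw [hF.vars 5 rfl, h5']
  · simp [hτ, h1, h2']
  · intro i hi
    rw [hF.arr 0 rfl, hA]
    simp [capInput]
  · simp [hτ]
  · simp [hτ, h1, h2', h3]
  · intro r hr
    rw [hF.arr 1 rfl, hA]
    simp only [List.length_singleton, Nat.lt_one_iff] at hr
    subst hr
    exact ⟨fun i _ => by simp [capInput], by simp [capInput]⟩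
  · simp
  · simpa using Reach.init
  · simp
  · simp
  · rw [hF.vars 7 rfl, hv 7] <;> simp [capInput]
  · rw [hF.vars 8 rfl, hv 8] <;> simp [capInput]
  · simp
  · simp
  · intro _
    rw [hF.vars 11 rfl, hv 11] <;> simp [capInput]

/-- The decision procedure: set up, search, and copy the answer to variable `0`. -/
def capProg : RamProg := seq initProg (seq searchProg (add 0 11 3))

theorem capProg_spec (k : ℕ) (xs : List ℤ) (hxs : xs.Nodup) :
    Runs capProg (capInput k xs) (3 + (k * 3 + 2 + (k * 3 + 2 + 3)) +
        (2 ^ (8 * k ^ 2) * (visitTime k xs.length (2 ^ (8 * k ^ 2)) + 1) + 1 + 1)) fun τ =>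
      (CAP {x : ℤ | x ∈ xs} k → τ.vars 0 = 1) ∧ (¬ CAP {x : ℤ | x ∈ xs} k → τ.vars 0 = 0) := by
  have hx : Set.InjOn (fun i => xs.getD i 0) (Finset.range xs.length) := by
    intro i hi j hj hij
    have hi' : i < xs.length := by simpa using hi
    have hj' : j < xs.length := by simpa using hj
    simp only [List.getD_eq_getElem _ _ hi', List.getD_eq_getElem _ _ hj'] at hij
    exact (hxs.getElem_inj_iff).1 hij
  have hX : {x : ℤ | x ∈ xs} =
      ((Finset.range xs.length).image fun i => xs.getD i 0 : Finset ℤ) := by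
    ext y
    simp only [Set.mem_ofPred_eq, Finset.coe_image, Set.mem_image, Finset.mem_coe,
      Finset.mem_range]
    constructor
    · intro hy
      obtain ⟨i, hi, rfl⟩ := List.getElem_of_mem hy
      exact ⟨i, hi, List.getD_eq_getElem _ _ hi⟩
    · rintro ⟨i, hi, rfl⟩
      rw [List.getD_eq_getElem _ _ hi]
      exact List.getElem_mem hi
  obtain ⟨V, hV, hVR⟩ := exists_states_finset k
    ((Finset.range xs.length).image fun i => xs.getD i 0)
  refine Runs.seq (initProg_spec k xs) fun τ _ hI => ?_
  refine Runs.seq (searchProg_spec hx (fun L hL => ?_) hI) fun υ _ ⟨hE, hyes, hno⟩ => ?_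
  · rw [← List.toFinset_card_of_nodup hL.1]
    refine (Finset.card_le_card fun p hp => ?_).trans hV
    exact hVR _ _ (hL.2 p (List.mem_toFinset.1 hp))
  · refine Runs.of_eval (p := add 0 11 3) rfl ?_
    rw [hX, cap_iff_reach]
    simpa [hE.v3] using And.intro hyes hno

/-! ### The running time -/

/-- Every factor is at most `Z`, so the number of steps is at most `1000 * Z ^ 5`. The exponents are
raised to `1000` because the claim has a single constant. -/
theorem capProg_time (k n : ℕ) :
    3 + (k * 3 + 2 + (k * 3 + 2 + 3)) +
        (2 ^ (8 * k ^ 2) * (visitTime k n (2 ^ (8 * k ^ 2)) + 1) + 1 + 1) ≤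
      1000 * 2 ^ (1000 * k ^ 2) * (n + 1) ^ 1000 := by
  set M := 2 ^ (8 * k ^ 2) with hM
  obtain ⟨Z, hZ⟩ : ∃ Z, Z = M * (n + 1) := ⟨_, rfl⟩
  have hM1 : 1 ≤ M := Nat.one_le_two_pow
  have hkM : 2 ^ k ≤ M := Nat.pow_le_pow_right (by norm_num)
    (by nlinarith [Nat.le_self_pow two_ne_zero k])
  have h1 : n + 1 ≤ Z := by rw [hZ]; exact Nat.le_mul_of_pos_left _ hM1
  have h2 : M ≤ Z := by rw [hZ]; exact Nat.le_mul_of_pos_right _ n.succ_pos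
  have h3 : 2 ^ k ≤ Z := hkM.trans h2
  have h4 : k ≤ Z := Nat.lt_two_pow_self.le.trans h3
  have h5 : n ≤ Z := by omega
  have hZ1 : 1 ≤ Z := by omega
  have hZ2 : Z ≤ Z ^ 2 := Nat.le_self_pow two_ne_zero Z
  have hZ4 : Z ^ 2 ≤ Z ^ 4 := Nat.pow_le_pow_right (by omega) (by norm_num)
  have hZ5 : Z ^ 4 ≤ Z ^ 5 := Nat.pow_le_pow_right (by omega) (by norm_num)
  have hins : insertTime n M ≤ 40 * Z ^ 2 := by
    have : insertTime n M ≤ 2 + (Z * (1 + (Z * 8 + 2) + 3 + 2) + 2) + (Z * 6 + 2 + 2 + 1) := by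
      unfold insertTime
      gcongr
    linarith
  have hexp : expandTime n M ≤ 100 * Z ^ 2 := by
    have : expandTime n M ≤ Z * 6 + 2 + (1 + (Z * (Z * 7 + 2 + 2) + 2 + (2 +
        (Z * (Z * 7 + 2 + 2) + 2 + (2 + 40 * Z ^ 2))))) := by
      unfold expandTime
      gcongr
    linarith
  have htry : tryTime k n M ≤ 140 * Z ^ 2 := by
    have : tryTime k n M ≤ 8 + (Z * (1 + (Z * 9 + 2) + 2) + 2) + (100 * Z ^ 2 + 1) := by
      unfold tryTime
      gcongr
    linarith
  have hpair : pairsTime k n M ≤ 160 * Z ^ 4 := by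
    have : pairsTime k n M ≤ Z * (Z * (140 * Z ^ 2 + 2) + 2 + 2) + 2 := by
      unfold pairsTime
      gcongr
    linarith
  have hvis : visitTime k n M ≤ 220 * Z ^ 4 := by
    have : visitTime k n M ≤ Z * 6 + 2 + (1 + (Z * 5 + 2) +
        (2 + (Z * (1 + (1 + (Z * 7 + 2)) + 6 + 2) + 2 + (1 + (160 * Z ^ 4 + 1 + 2))))) := by
      unfold visitTime
      gcongr
    linarith
  calc _ ≤ 3 + (Z * 3 + 2 + (Z * 3 + 2 + 3)) + (Z * (220 * Z ^ 4 + 1) + 1 + 1) := by gcongr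
    _ ≤ 1000 * Z ^ 5 := by linarith
    _ = 1000 * 2 ^ (40 * k ^ 2) * (n + 1) ^ 5 := by
        rw [hZ, mul_pow, hM, ← pow_mul]; ring_nf
    _ ≤ 1000 * 2 ^ (1000 * k ^ 2) * (n + 1) ^ 1000 := by
        gcongr <;> omega

theorem theorem1 :
    ∃ (P : RamProg) (C : ℕ), ∀ (k : ℕ) (xs : List ℤ), xs.Nodup →
      ∃ (t : ℕ) (τ : RamState),
        RamProg.Exec P (capInput k xs) t τ ∧
        t ≤ C * 2 ^ (C * k ^ 2) * (xs.length + 1) ^ C ∧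
        (CAP {x : ℤ | x ∈ xs} k → τ.vars 0 = 1) ∧
        (¬ CAP {x : ℤ | x ∈ xs} k → τ.vars 0 = 0) := by
  refine ⟨capProg, 1000, fun k xs hxs => ?_⟩
  obtain ⟨t, τ, he, ht, hτ⟩ := capProg_spec k xs hxs
  exact ⟨t, τ, he, ht.trans (capProg_time k _), hτ⟩
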